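/- Let $G$ be a connected (finite-dimensional, real) Lie group with Lie algebra $\mathfrak g$, let $H\subseteq G$ be a closed subgroup with Lie algebra $\mathfrak h$, and let $M=G/H$ be the homogeneous manifold, with its smooth structure for which the projection $p:G\to G/H$ is a smooth submersion. Put $\bar e=H\in M$, let $q:\mathfrak g\to\mathfrak g/\mathfrak h$ be the canonical projection, let $\lambda_g:M\to M$, $\lambda_g(aH)=gaH$, and let $\Phi_e:\mathfrak g/\mathfrak h\to T_{\bar e}M$, $\Phi_e(u+\mathfrak h)=T_ep(u)$. We view bivectors on a finite-dimensional vector space $V$ as alternating bilinear forms on $V^*$, and elements of $\otimes^3V$ as trilinear forms on $V^*$. For $a\in H$ let $\overline{\mathrm{Ad}}_a$ be the map induced by $\mathrm{Ad}_a$ on $\mathfrak g/\mathfrak h$; $r\in\wedge^2(\mathfrak g/\mathfrak h)$ is called $\mathrm{Ad}(H)$-invariant if $r(\alpha\circ\overline{\mathrm{Ad}}_a,\beta\circ\overline{\mathrm{Ad}}_a)=r(\alpha,\beta)$ for all $a\in H$ and $\alpha,\beta\in(\mathfrak g/\mathfrak h)^*$. For $\tilde r\in\wedge^2\mathfrak g$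 and $\eta,\xi\in\mathfrak g^*$ let $\eta^{\tilde\#}\in\mathfrak g$ be given by $\langle\zeta,\eta^{\tilde\#}\rangle=\tilde r(\eta,\zeta)$ for all $\zeta\in\mathfrak g^*$, and put $[\eta,\xi]_{\tilde r}=-\mathrm{ad}^*_{\eta^{\tilde\#}}\xi+\mathrm{ad}^*_{\xi^{\tilde\#}}\eta$, where $\langle\mathrm{ad}_u^*\xi,v\rangle=\langle\xi,[u,v]\rangle$. Identify $(\mathfrak g/\mathfrak h)^*$ with the annihilator $\mathfrak h^\circ\subseteq\mathfrak g^*$ of $\mathfrak h$ via $q^*$. For $r\in\wedge^2(\mathfrak g/\mathfrak h)$ and a lift $\tilde r\in\wedge^2\mathfrak g$ of $r$ (that is, $\wedge^2q(\tilde r)=r$; such lifts exist) put $$\llbracket r,r\rrbracket(\eta,\xi,\varepsilon)=\big\langle\varepsilon,\;[\eta,\xi]_{\tilde r}^{\tilde\#}-[\eta^{\tilde\#},\xi^{\tilde\#}]\big\rangle,\qquad \eta,\xi,\varepsilon\in\mathfrak h^\circ .$$ (1) If $r$ is $\mathrm{Ad}(H)$-invariant, then the tensor $\llbracket r,r\rrbracket\in\otimes^3(\mathfrak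 g/\mathfrak h)$ does not depend on the choice of the lift $\tilde r$. (2) Let $\pi$ be a smooth skew-symmetric bivector field on $M$ that is $G$-invariant, i.e. $\pi(\lambda_g^*\alpha,\lambda_g^*\beta)=\pi(\alpha,\beta)\circ\lambda_g$ for all $g\in G$ and all one-forms $\alpha,\beta$ on $M$. Then there is exactly one $r\in\wedge^2(\mathfrak g/\mathfrak h)$ with $\pi_{\bar e}(\alpha,\beta)=r(\alpha\circ\Phi_e,\beta\circ\Phi_e)$ for all $\alpha,\beta\in T^*_{\bar e}M$; this $r$ is $\mathrm{Ad}(H)$-invariant; and $\pi$ is a Poisson bivector field, i.e. its Schouten–Nijenhuis bracket $[\pi,\pi]_S$ vanishes, if and only if $\llbracket r,r\rrbracket=0$. -/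

import Mathlib

open scoped Manifold ContDiff
open Module

set_option maxSynthPendingDepth 3

noncomputable section

/-! ### Bivectors on a finite-dimensional vector space -/

section Algebra

variable {V W : Type*} [AddCommGroup V] [Module ℝ V] [AddCommGroup W] [Module ℝ W]

/-- The space `∧² V` of bivectors of a finite-dimensional real vector space `V`, realised as the
alternating bilinear forms `(α, β) ↦ r(α, β)` on the dual space `V*`. -/
@[ext] structure Bivector (V : Type*) [AddCommGroup V] [Module ℝ V] where
  form : LinearMap.BilinForm ℝ (Dual ℝ V)
  alternating : ∀ α, form α α = 0

/-- `∧² f : ∧² V → ∧² W` for a linear map `f : V → W`: `(∧² f r)(α, β) = r(α ∘ f, β ∘ f)`. -/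
def Bivector.map (f : V →ₗ[ℝ] W) (r : Bivector V) : Bivector W where
  form := r.form.compl₁₂ f.dualMap f.dualMap
  alternating α := r.alternating (f.dualMap α)

/-- The map `η ↦ η^#`, `V* → V`, of a bivector: `⟨ξ, η^#⟩ = r(η, ξ)` for all `ξ ∈ V*`. -/
def Bivector.sharp [FiniteDimensional ℝ V] (r : Bivector V) : Dual ℝ V →ₗ[ℝ] V :=
  (evalEquiv ℝ V).symm.toLinearMap ∘ₗ r.form

theorem Bivector.apply_sharp [FiniteDimensional ℝ V] (r : Bivector V) (η ξ : Dual ℝ V) :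
    ξ (r.sharp η) = r.form η ξ := by
  simp [Bivector.sharp]

/-- For a subspace `S ⊆ V` with projection `q : V → V ⧸ S`, every element of `∧²(V ⧸ S)` has a lift
along `∧² q`. -/
theorem Bivector.exists_lift (S : Submodule ℝ V) (r : Bivector (V ⧸ S)) :
    ∃ rt : Bivector V, rt.map S.mkQ = r := by
  obtain ⟨s, hs⟩ := S.mkQ.exists_rightInverse_of_surjective S.range_mkQ
  refine ⟨r.map s, Bivector.ext ?_⟩
  refine LinearMap.ext fun α => LinearMap.ext fun β => ?_
  have h : ∀ γ : Dual ℝ (V ⧸ S), s.dualMap (S.mkQ.dualMap γ) = γ := by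
    intro γ
    refine LinearMap.ext fun v => ?_
    have := LinearMap.congr_fun hs v
    simpa using congrArg γ this
  change r.form (s.dualMap (S.mkQ.dualMap α)) (s.dualMap (S.mkQ.dualMap β)) = r.form α β
  rw [h, h]

variable {L : Type*} [LieRing L] [LieAlgebra ℝ L]

/-- `ad_u^* ξ`, the transpose of `ad_u` applied to `ξ`: `⟨ad_u^* ξ, v⟩ = ⟨ξ, [u, v]⟩`. -/
def adStar (u : L) (ξ : Dual ℝ L) : Dual ℝ L := ξ ∘ₗ (LieAlgebra.ad ℝ L u : L →ₗ[ℝ] L)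

variable [FiniteDimensional ℝ L]

/-- The bracket `[η, ξ]_r = - ad_{η^#}^* ξ + ad_{ξ^#}^* η` on `L*` defined by `r ∈ ∧² L`. -/
def dualBracket (r : Bivector L) (η ξ : Dual ℝ L) : Dual ℝ L :=
  -adStar (r.sharp η) ξ + adStar (r.sharp ξ) η

/-- The element of `⊗³(L ⧸ S)` (as a trilinear form on `(L ⧸ S)*`, which `q^*` identifies with the
annihilator `S°` of `S` in `L*`) built from `r ∈ ∧² L`:
`(η, ξ, ε) ↦ ⟨ε, [η, ξ]_r^# - [η^#, ξ^#]⟩` for `η, ξ, ε ∈ S°`. -/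
def yangBaxterOfLift (S : Submodule ℝ L) (r : Bivector L) :
    Dual ℝ (L ⧸ S) →ₗ[ℝ] Dual ℝ (L ⧸ S) →ₗ[ℝ] Dual ℝ (L ⧸ S) →ₗ[ℝ] ℝ :=
  LinearMap.mk₂ ℝ
    (fun η ξ => Dual.eval ℝ (L ⧸ S) (S.mkQ
      (r.sharp (dualBracket r (S.mkQ.dualMap η) (S.mkQ.dualMap ξ))
        - ⁅r.sharp (S.mkQ.dualMap η), r.sharp (S.mkQ.dualMap ξ)⁆)))
    (by
      intro a b c
      rw [← map_add, ← map_add]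
      congr 2
      have : dualBracket r (S.mkQ.dualMap (a + b)) (S.mkQ.dualMap c) =
          dualBracket r (S.mkQ.dualMap a) (S.mkQ.dualMap c)
            + dualBracket r (S.mkQ.dualMap b) (S.mkQ.dualMap c) := by
        refine LinearMap.ext fun v => ?_
        simp only [dualBracket, adStar, map_add, LinearMap.add_apply, LinearMap.neg_apply,
          LinearMap.comp_apply]
        ring
      rw [this]
      simp only [map_add, add_lie]
      abel)
    (by
      intro c a b
      rw [← map_smul, ← map_smul]
      congr 2
      have : dualBracket r (S.mkQ.dualMap (c • a)) (S.mkQ.dualMap b) =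
          c • dualBracket r (S.mkQ.dualMap a) (S.mkQ.dualMap b) := by
        refine LinearMap.ext fun v => ?_
        simp only [dualBracket, adStar, map_smul, LinearMap.add_apply, LinearMap.neg_apply,
          LinearMap.comp_apply, LinearMap.smul_apply, smul_eq_mul]
        ring
      rw [this]
      simp only [map_smul, smul_lie, smul_sub])
    (by
      intro a b c
      rw [← map_add, ← map_add]
      congr 2
      have : dualBracket r (S.mkQ.dualMap a) (S.mkQ.dualMap (b + c)) =
          dualBracket r (S.mkQ.dualMap a) (S.mkQ.dualMap b)
            + dualBracket r (S.mkQ.dualMap a) (S.mkQ.dualMap c) := by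
        refine LinearMap.ext fun v => ?_
        simp only [dualBracket, adStar, map_add, LinearMap.add_apply, LinearMap.neg_apply,
          LinearMap.comp_apply]
        ring
      rw [this]
      simp only [map_add, lie_add]
      abel)
    (by
      intro c a b
      rw [← map_smul, ← map_smul]
      congr 2
      have : dualBracket r (S.mkQ.dualMap a) (S.mkQ.dualMap (c • b)) =
          c • dualBracket r (S.mkQ.dualMap a) (S.mkQ.dualMap b) := by
        refine LinearMap.ext fun v => ?_
        simp only [dualBracket, adStar, map_smul, LinearMap.add_apply, LinearMap.neg_apply,
          LinearMap.comp_apply, LinearMap.smul_apply, smul_eq_mul]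
        ring
      rw [this]
      simp only [map_smul, lie_smul, smul_sub])

/-- The Yang–Baxter-type tensor `⟦r, r⟧ ∈ ⊗³(L ⧸ S)` of `r ∈ ∧²(L ⧸ S)`, computed from some lift
`r̃ ∈ ∧² L` of `r`. -/
def yangBaxter (S : Submodule ℝ L) (r : Bivector (L ⧸ S)) :
    Dual ℝ (L ⧸ S) →ₗ[ℝ] Dual ℝ (L ⧸ S) →ₗ[ℝ] Dual ℝ (L ⧸ S) →ₗ[ℝ] ℝ :=
  yangBaxterOfLift S (Bivector.exists_lift S r).choose

end Algebra

/-! ### Bivector fields on manifolds and the Schouten–Nijenhuis bracket -/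

section Manifold

variable (F : Type*) [NormedAddCommGroup F] [NormedSpace ℝ F]
  (M : Type*) [TopologicalSpace M] [ChartedSpace F M]

/-- A smooth skew-symmetric bivector field `π` on a manifold `M`: a smooth section of the bundle of
bilinear forms on `T*M`, alternating at every point. -/
structure BivectorField [IsManifold 𝓘(ℝ, F) ∞ M] where
  toFun : ∀ x : M, (TangentSpace 𝓘(ℝ, F) x →L[ℝ] ℝ) →L[ℝ] (TangentSpace 𝓘(ℝ, F) x →L[ℝ] ℝ) →L[ℝ] ℝ
  alternating : ∀ x α, toFun x α α = 0
  smooth : ContMDiff 𝓘(ℝ, F) (𝓘(ℝ, F).prod 𝓘(ℝ, (F →L[ℝ] ℝ) →L[ℝ] (F →L[ℝ] ℝ) →L[ℝ] ℝ)) ∞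
    (fun x => Bundle.TotalSpace.mk' ((F →L[ℝ] ℝ) →L[ℝ] (F →L[ℝ] ℝ) →L[ℝ] ℝ) x (toFun x))

variable {F M} [IsManifold 𝓘(ℝ, F) ∞ M]

/-- The bracket of functions `{f, g}_P = P(df, dg)` of a bivector field `P`. -/
def BivectorField.bracket (P : BivectorField F M) (f g : M → ℝ) (x : M) : ℝ :=
  P.toFun x (mvfderiv 𝓘(ℝ, F) f x) (mvfderiv 𝓘(ℝ, F) g x)

/-- The function, smooth near `x` and linear in the preferred chart at `x`, whose differential at
`x` is the covector `α`. -/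
def covectorFun (x : M) (α : TangentSpace 𝓘(ℝ, F) x →L[ℝ] ℝ) : M → ℝ :=
  fun y => (α : F →L[ℝ] ℝ) (extChartAt 𝓘(ℝ, F) x y)

/-- The Schouten–Nijenhuis bracket `[P, Q]_S` of two bivector fields, as a trilinear form on each
cotangent space. It is the trivector field with
`[P, Q]_S(df, dg, dh) = ∑ ({{f, g}_P, h}_Q + {{f, g}_Q, h}_P)`, the sum running over the cyclic
permutations of `f, g, h`; it is evaluated on `α, β, γ ∈ T*_x M` by using for `f, g, h` the local
functions that are linear in the chart at `x` and have differentials `α, β, γ` at `x`, so that this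
is the usual coordinate formula for `[P, Q]_S`. -/
def schoutenBracket (P Q : BivectorField F M) (x : M)
    (α β γ : TangentSpace 𝓘(ℝ, F) x →L[ℝ] ℝ) : ℝ :=
  let f := covectorFun x α
  let g := covectorFun x β
  let h := covectorFun x γ
  (Q.bracket (P.bracket f g) h x + P.bracket (Q.bracket f g) h x)
    + (Q.bracket (P.bracket g h) f x + P.bracket (Q.bracket g h) f x)
    + (Q.bracket (P.bracket h f) g x + P.bracket (Q.bracket h f) g x)

/-- `π` is a Poisson bivector field: `[π, π]_S = 0`. -/
def BivectorField.IsPoisson (P : BivectorField F M) : Prop :=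
  ∀ x : M, schoutenBracket P P x = 0

end Manifold

/-! ### Closed subgroups of Lie groups and homogeneous manifolds -/

section Homogeneous

variable (E : Type*) [NormedAddCommGroup E] [NormedSpace ℝ E]
  {G : Type*} [TopologicalSpace G] [ChartedSpace E G] [Group G]

instance tangentSpace_finiteDimensional [FiniteDimensional ℝ E] (g : G) :
    FiniteDimensional ℝ (TangentSpace 𝓘(ℝ, E) g) :=
  inferInstanceAs (FiniteDimensional ℝ E)

instance lieGroup_minSmoothness [LieGroup 𝓘(ℝ, E) ∞ G] :
    LieGroup 𝓘(ℝ, E) (minSmoothness ℝ 3) G :=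
  LieGroup.of_le (n := ∞) (by simpa using ENat.LEInfty.out)

variable [LieGroup 𝓘(ℝ, E) ∞ G]

theorem mfderiv_mul_at_one {a b : G} (ha : a = 1) (hb : b = 1) (u v : E) :
    (mfderiv (𝓘(ℝ, E).prod 𝓘(ℝ, E)) 𝓘(ℝ, E) (fun p : G × G => p.1 * p.2) (a, b) :
      E × E →L[ℝ] E) (u, v) = u + v := by
  subst ha hb
  have h := mfderiv_prod_eq_add_apply (I := 𝓘(ℝ, E)) (I' := 𝓘(ℝ, E)) (I'' := 𝓘(ℝ, E))
    (f := fun p : G × G => p.1 * p.2) (p := ((1 : G), (1 : G))) (v := ((u, v) : E × E))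
    ((contMDiff_mul 𝓘(ℝ, E) ∞).mdifferentiableAt (by simp))
  refine h.trans ?_
  have h1 : (fun z : G => z * 1) = id := funext mul_one
  have h2 : (fun z : G => 1 * z) = id := funext one_mul
  change (mfderiv 𝓘(ℝ, E) 𝓘(ℝ, E) (fun z : G => z * 1) 1 : E →L[ℝ] E) u
    + (mfderiv 𝓘(ℝ, E) 𝓘(ℝ, E) (fun z : G => 1 * z) 1 : E →L[ℝ] E) v = u + v
  have h3 : (mfderiv 𝓘(ℝ, E) 𝓘(ℝ, E) (id : G → G) 1 : E →L[ℝ] E)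
    = ContinuousLinearMap.id ℝ E := mfderiv_id
  have h4 : (mfderiv 𝓘(ℝ, E) 𝓘(ℝ, E) (fun z : G => z * 1) 1 : E →L[ℝ] E)
    = ContinuousLinearMap.id ℝ E := by rw [h1]; exact h3
  have h5 : (mfderiv 𝓘(ℝ, E) 𝓘(ℝ, E) (fun z : G => 1 * z) 1 : E →L[ℝ] E)
    = ContinuousLinearMap.id ℝ E := by rw [h2]; exact h3
  rw [h4, h5]
  rfl

/-- The Lie algebra `𝔥 ⊆ 𝔤 = T_1 G` of a closed subgroup `H` of a Lie group `G`: the set of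
velocities `c'(0)` of curves `c : ℝ → H` with `c(0) = 1` that are differentiable at `0` as curves
in `G`. -/
def subgroupLieAlgebra (H : Subgroup G) : Submodule ℝ (GroupLieAlgebra 𝓘(ℝ, E) G) where
  carrier := {u | ∃ c : ℝ → G, c 0 = 1 ∧ (∀ t, c t ∈ H) ∧
    HasMFDerivAt 𝓘(ℝ, ℝ) 𝓘(ℝ, E) c 0 (ContinuousLinearMap.toSpanSingleton ℝ (u : E))}
  add_mem' := by
    rintro u v ⟨c, hc, hcH, hcu⟩ ⟨d, hd, hdH, hdv⟩
    refine ⟨fun t => c t * d t, by simp [hc, hd], fun t => H.mul_mem (hcH t) (hdH t), ?_⟩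
    have hm : MDifferentiableAt (𝓘(ℝ, E).prod 𝓘(ℝ, E)) 𝓘(ℝ, E)
        (fun p : G × G => p.1 * p.2) (c 0, d 0) :=
      (contMDiff_mul 𝓘(ℝ, E) ∞).mdifferentiableAt (by simp)
    have h := hm.hasMFDerivAt.comp (0 : ℝ) (hcu.prodMk hdv)
    refine h.congr_mfderiv ?_
    refine ContinuousLinearMap.ext_ring ?_
    refine (mfderiv_mul_at_one E hc hd _ _).trans ?_
    change (1 : ℝ) • (u : E) + (1 : ℝ) • (v : E) = (1 : ℝ) • ((u : E) + (v : E))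
    rw [smul_add]
  zero_mem' := by
    refine ⟨fun _ => 1, rfl, fun _ => H.one_mem, ?_⟩
    refine (hasMFDerivAt_const (1 : G) (0 : ℝ)).congr_mfderiv ?_
    refine ContinuousLinearMap.ext_ring ?_
    simp
    rfl
  smul_mem' := by
    rintro k u ⟨c, hc, hcH, hcu⟩
    refine ⟨fun t => c (k * t), by simp [hc], fun t => hcH _, ?_⟩
    have hk : HasMFDerivAt 𝓘(ℝ, ℝ) 𝓘(ℝ, ℝ) (fun t : ℝ => k * t) 0
        (ContinuousLinearMap.toSpanSingleton ℝ k) := by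
      have h : HasDerivAt (fun t : ℝ => k * t) k 0 := by
        simpa using (hasDerivAt_id (0 : ℝ)).const_mul k
      exact h.hasFDerivAt.hasMFDerivAt
    have hcu' : HasMFDerivAt 𝓘(ℝ, ℝ) 𝓘(ℝ, E) c (k * 0)
        (ContinuousLinearMap.toSpanSingleton ℝ (u : E)) := by
      rw [mul_zero]; exact hcu
    refine (hcu'.comp (0 : ℝ) hk).congr_mfderiv ?_
    refine ContinuousLinearMap.ext_ring ?_
    change ((1 : ℝ) • k) • (u : E) = (1 : ℝ) • (k • (u : E))
    rw [one_smul, one_smul]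

/-- `Ad_a : 𝔤 → 𝔤`, the differential at `1` of the conjugation `g ↦ a g a⁻¹`. -/
def Ad (a : G) : GroupLieAlgebra 𝓘(ℝ, E) G →ₗ[ℝ] GroupLieAlgebra 𝓘(ℝ, E) G :=
  (mfderiv 𝓘(ℝ, E) 𝓘(ℝ, E) (fun g : G => a * g * a⁻¹) 1 : E →L[ℝ] E).toLinearMap

theorem Ad_mem (H : Subgroup G) {a : G} (ha : a ∈ H) :
    subgroupLieAlgebra E H ≤ (subgroupLieAlgebra E H).comap (Ad E a) := by
  rintro u ⟨c, hc, hcH, hcu⟩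
  refine ⟨fun t => a * c t * a⁻¹, by simp [hc],
    fun t => H.mul_mem (H.mul_mem ha (hcH t)) (H.inv_mem ha), ?_⟩
  have hm : MDifferentiableAt 𝓘(ℝ, E) 𝓘(ℝ, E) (fun g : G => a * g * a⁻¹) (c 0) :=
    (((contMDiff_const (c := a)).mul contMDiff_id).mul
      (contMDiff_const (c := a⁻¹)) : ContMDiff 𝓘(ℝ, E) 𝓘(ℝ, E) ∞ _).mdifferentiableAt (by simp)
  refine (hm.hasMFDerivAt.comp (0 : ℝ) hcu).congr_mfderiv ?_
  refine ContinuousLinearMap.ext_ring ?_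
  have hL : ∀ b : G, b = 1 →
      (mfderiv 𝓘(ℝ, E) 𝓘(ℝ, E) (fun g : G => a * g * a⁻¹) b : E →L[ℝ] E)
        = (mfderiv 𝓘(ℝ, E) 𝓘(ℝ, E) (fun g : G => a * g * a⁻¹) 1 : E →L[ℝ] E) := by
    rintro b rfl; rfl
  change (mfderiv 𝓘(ℝ, E) 𝓘(ℝ, E) (fun g : G => a * g * a⁻¹) (c 0) : E →L[ℝ] E)
      ((1 : ℝ) • (u : E))
    = (1 : ℝ) • (mfderiv 𝓘(ℝ, E) 𝓘(ℝ, E) (fun g : G => a * g * a⁻¹) 1 : E →L[ℝ] E) (u : E)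
  rw [hL (c 0) hc, one_smul]
  exact (one_smul ℝ _).symm

/-- `\overline{Ad}_a : 𝔤/𝔥 → 𝔤/𝔥` for `a ∈ H`, induced by `Ad_a`. -/
def AdBar (H : Subgroup G) (a : H) :
    (GroupLieAlgebra 𝓘(ℝ, E) G ⧸ subgroupLieAlgebra E H) →ₗ[ℝ]
      (GroupLieAlgebra 𝓘(ℝ, E) G ⧸ subgroupLieAlgebra E H) :=
  (subgroupLieAlgebra E H).mapQ (subgroupLieAlgebra E H) (Ad E (a : G)) (Ad_mem E H a.2)

/-- `r ∈ ∧²(𝔤/𝔥)` is `Ad(H)`-invariant: `r(\overline{Ad}_a^* α, \overline{Ad}_a^* β) = r(α, β)`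
for all `a ∈ H` and `α, β ∈ (𝔤/𝔥)*`. -/
def Bivector.IsAdInvariant {H : Subgroup G}
    (r : Bivector (GroupLieAlgebra 𝓘(ℝ, E) G ⧸ subgroupLieAlgebra E H)) : Prop :=
  ∀ (a : H) (α β : Dual ℝ (GroupLieAlgebra 𝓘(ℝ, E) G ⧸ subgroupLieAlgebra E H)),
    r.form (α ∘ₗ AdBar E H a) (β ∘ₗ AdBar E H a) = r.form α β

variable (F : Type*) [NormedAddCommGroup F] [NormedSpace ℝ F]

/-- The manifold structure on `G ⧸ H` (whose topology is the quotient topology) is that of the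
homogeneous manifold `G ⧸ H`: the one for which the projection `p : G → G ⧸ H` is a smooth
submersion. -/
class IsHomogeneousManifold (H : Subgroup G) [ChartedSpace F (G ⧸ H)] : Prop where
  isSubmersion : Manifold.IsSubmersion 𝓘(ℝ, E) 𝓘(ℝ, F) ∞ (QuotientGroup.mk : G → G ⧸ H)

variable (H : Subgroup G) [ChartedSpace F (G ⧸ H)]

/-- The differential `T_e p : 𝔤 → T_{ē}(G ⧸ H)` of the projection `p`, where `ē = H`. -/
def projDifferential :
    GroupLieAlgebra 𝓘(ℝ, E) G →ₗ[ℝ] TangentSpace 𝓘(ℝ, F) ((1 : G) : G ⧸ H) :=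
  (mfderiv 𝓘(ℝ, E) 𝓘(ℝ, F) (QuotientGroup.mk : G → G ⧸ H) 1).toLinearMap

theorem subgroupLieAlgebra_le_ker [hM : IsHomogeneousManifold E F H] :
    subgroupLieAlgebra E H ≤ LinearMap.ker (projDifferential E F H) := by
  rintro u ⟨c, hc, hcH, hcu⟩
  have hm : MDifferentiableAt 𝓘(ℝ, E) 𝓘(ℝ, F) (QuotientGroup.mk : G → G ⧸ H) (c 0) :=
    hM.isSubmersion.contMDiff.mdifferentiableAt (by simp)
  have h := hm.hasMFDerivAt.comp (0 : ℝ) hcu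
  have hconst : (QuotientGroup.mk : G → G ⧸ H) ∘ c = fun _ => ((1 : G) : G ⧸ H) := by
    funext t
    exact (QuotientGroup.eq.2 (by simpa using hcH t)).symm
  rw [hconst] at h
  have h0 := hasMFDerivAt_unique h (hasMFDerivAt_const ((1 : G) : G ⧸ H) (0 : ℝ))
  have h1 := congrArg (fun (L : ℝ →L[ℝ] F) => L 1) h0
  have hL : ∀ b : G, b = 1 →
      (mfderiv 𝓘(ℝ, E) 𝓘(ℝ, F) (QuotientGroup.mk : G → G ⧸ H) b : E →L[ℝ] F)
        = (mfderiv 𝓘(ℝ, E) 𝓘(ℝ, F) (QuotientGroup.mk : G → G ⧸ H) 1 : E →L[ℝ] F) := by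
    rintro b rfl; rfl
  change (mfderiv 𝓘(ℝ, E) 𝓘(ℝ, F) (QuotientGroup.mk : G → G ⧸ H) (c 0) : E →L[ℝ] F)
    ((1 : ℝ) • (u : E)) = 0 at h1
  rw [hL (c 0) hc, one_smul] at h1
  exact h1

/-- `Φ_e : 𝔤/𝔥 → T_{ē}(G ⧸ H)`, `Φ_e(u + 𝔥) = T_e p(u)`. -/
def Phi [IsHomogeneousManifold E F H] :
    (GroupLieAlgebra 𝓘(ℝ, E) G ⧸ subgroupLieAlgebra E H) →ₗ[ℝ]
      TangentSpace 𝓘(ℝ, F) ((1 : G) : G ⧸ H) :=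
  (subgroupLieAlgebra E H).liftQ (projDifferential E F H) (subgroupLieAlgebra_le_ker E F H)

variable {F H} [IsManifold 𝓘(ℝ, F) ∞ (G ⧸ H)]

/-- `π` is `G`-invariant: `π(λ_g^* α, λ_g^* β) = π(α, β) ∘ λ_g`, where `λ_g(x) = g x`. -/
def BivectorField.IsInvariant (π : BivectorField F (G ⧸ H)) : Prop :=
  ∀ (g : G) (x : G ⧸ H) (α β : TangentSpace 𝓘(ℝ, F) (g • x) →L[ℝ] ℝ),
    π.toFun x (α ∘L mfderiv 𝓘(ℝ, F) 𝓘(ℝ, F) (fun y : G ⧸ H => g • y) x)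
      (β ∘L mfderiv 𝓘(ℝ, F) 𝓘(ℝ, F) (fun y : G ⧸ H => g • y) x) = π.toFun (g • x) α β

/-- `r ∈ ∧²(𝔤/𝔥)` is the bivector associated with `π`, i.e. it corresponds to the value of `π` at
`ē = H` under `Φ_e`: `π_{ē}(α, β) = r(Φ_e^* α, Φ_e^* β)` for all covectors `α, β` at `ē`. -/
def BivectorField.IsAssociated [IsHomogeneousManifold E F H] (π : BivectorField F (G ⧸ H))
    (r : Bivector (GroupLieAlgebra 𝓘(ℝ, E) G ⧸ subgroupLieAlgebra E H)) : Prop :=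
  ∀ α β : TangentSpace 𝓘(ℝ, F) ((1 : G) : G ⧸ H) →L[ℝ] ℝ,
    π.toFun ((1 : G) : G ⧸ H) α β =
      r.form (α.toLinearMap ∘ₗ Phi E F H) (β.toLinearMap ∘ₗ Phi E F H)

end Homogeneous

end

/-! Write `η^#` for the contraction of a lift `r̃` with `η`. Moving `#` across the pairing by
skew-symmetry turns the tensor into minus the cyclic sum of `⟨η, [ξ^#, ε^#]⟩`
(`yangBaxterOfLift_apply`); both claims are read off from this form.

Independence of the lift: on covectors annihilating `𝔥`, the maps `#` of two lifts differ by
elements of `𝔥`. As `𝔥` is a subalgebra, brackets of two such corrections pair to zero. The mixed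
terms cancel in pairs by infinitesimal invariance, `⟨ξ, [u, η^#]⟩ = ⟨η, [u, ξ^#]⟩` for `u ∈ 𝔥`,
which is `Ad(H)`-invariance differentiated along a curve in `H` with velocity `u`. This rests on the
derivative of `Ad` being `ad` (`exists_hasDerivAt_AdL`).

Poisson criterion: since `p` is a submersion with fibre `H` over `ē`, `Φ_e` is an isomorphism
(`Phi_bijective`), so `r` is `π_ē` transported. After pulling functions back to `G`, invariance says
that `{f, g}` is the constant form `r̃` applied to the derivatives of `f` and `g` along
left-invariant fields. Hence `{{f, g}, h}` involves only second left derivatives of `f` and `g`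
(`BivectorField.bracket_bracket`). In the cyclic sum these occur antisymmetrised, and the
antisymmetrised left Hessian of `f` is `df` on the Lie bracket (`exists_hasMFDerivAt_leftDeriv`).
The result is that `[π, π]_S` at `aH` is twice the tensor `⟦r, r⟧` on covectors pulled back by `Tλ_a
∘ Φ_e` (`schoutenBracket_quotient_mk`), and the equivalence follows. -/

noncomputable section

/-! ### Linear algebra: the cyclic form of the tensor and the change of lift -/

section LiftIndependence

variable {L : Type*} [LieRing L] [LieAlgebra ℝ L] [FiniteDimensional ℝ L]

theorem Bivector.form_swap {V : Type*} [AddCommGroup V] [Module ℝ V] (r : Bivector V)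
    (α β : Dual ℝ V) : r.form α β = -r.form β α := by
  have h := r.alternating (α + β)
  simp only [map_add, LinearMap.add_apply, r.alternating] at h
  linarith

theorem Bivector.apply_sharp_swap {V : Type*} [AddCommGroup V] [Module ℝ V]
    [FiniteDimensional ℝ V] (r : Bivector V) (α β : Dual ℝ V) :
    α (r.sharp β) = -β (r.sharp α) := by
  rw [r.apply_sharp, r.apply_sharp, r.form_swap]

/-- The cyclic form of the Yang–Baxter-type tensor. -/
theorem yangBaxterOfLift_apply (S : Submodule ℝ L) (r : Bivector L) (η ξ ε : Dual ℝ (L ⧸ S)) :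
    yangBaxterOfLift S r η ξ ε =
      -(S.mkQ.dualMap η ⁅r.sharp (S.mkQ.dualMap ξ), r.sharp (S.mkQ.dualMap ε)⁆
        + S.mkQ.dualMap ξ ⁅r.sharp (S.mkQ.dualMap ε), r.sharp (S.mkQ.dualMap η)⁆
        + S.mkQ.dualMap ε ⁅r.sharp (S.mkQ.dualMap η), r.sharp (S.mkQ.dualMap ξ)⁆) := by
  have h1 : yangBaxterOfLift S r η ξ ε = S.mkQ.dualMap ε
      (r.sharp (dualBracket r (S.mkQ.dualMap η) (S.mkQ.dualMap ξ))
        - ⁅r.sharp (S.mkQ.dualMap η), r.sharp (S.mkQ.dualMap ξ)⁆) := rfl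
  rw [h1]
  generalize S.mkQ.dualMap η = a
  generalize S.mkQ.dualMap ξ = b
  generalize S.mkQ.dualMap ε = c
  rw [map_sub, r.apply_sharp_swap]
  have h2 : dualBracket r a b (r.sharp c) =
      -b ⁅r.sharp a, r.sharp c⁆ + a ⁅r.sharp b, r.sharp c⁆ := rfl
  rw [h2, ← lie_skew (r.sharp c) (r.sharp a), map_neg]
  ring

/-- If a form on `L ⧸ S` is infinitesimally invariant under a subalgebra `S`, then the
Yang–Baxter-type tensor does not depend on the lift. -/
theorem yangBaxterOfLift_eq_of_map_eq (S : Submodule ℝ L) (hS : ∀ u ∈ S, ∀ v ∈ S, ⁅u, v⁆ ∈ S)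
    (r₁ r₂ : Bivector L) (h : r₁.map S.mkQ = r₂.map S.mkQ)
    (hinv : ∀ u ∈ S, ∀ η ξ : Dual ℝ (L ⧸ S),
      S.mkQ.dualMap ξ ⁅u, r₁.sharp (S.mkQ.dualMap η)⁆ =
        S.mkQ.dualMap η ⁅u, r₁.sharp (S.mkQ.dualMap ξ)⁆) :
    yangBaxterOfLift S r₁ = yangBaxterOfLift S r₂ := by
  have hmem : ∀ η : Dual ℝ (L ⧸ S),
      ∃ u ∈ S, r₂.sharp (S.mkQ.dualMap η) = r₁.sharp (S.mkQ.dualMap η) + u := by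
    intro η
    refine ⟨r₂.sharp (S.mkQ.dualMap η) - r₁.sharp (S.mkQ.dualMap η), ?_, by abel⟩
    -- A vector lies in `S` as soon as every functional on `L ⧸ S` kills its class; on the
    -- difference of the two sharps such functionals only see the common image in `∧²(L ⧸ S)`.
    rw [← Submodule.Quotient.mk_eq_zero, ← Submodule.mkQ_apply,
      ← Module.forall_dual_apply_eq_zero_iff ℝ]
    intro ξ
    change S.mkQ.dualMap ξ _ = 0
    rw [map_sub, r₁.apply_sharp, r₂.apply_sharp, sub_eq_zero]
    exact (congrArg (fun r : Bivector (L ⧸ S) => r.form η ξ) h).symm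
  have hz : ∀ (η : Dual ℝ (L ⧸ S)), ∀ u ∈ S, S.mkQ.dualMap η u = 0 := by
    intro η u hu
    change η (S.mkQ u) = 0
    rw [Submodule.mkQ_apply, (Submodule.Quotient.mk_eq_zero S).2 hu, map_zero]
  refine LinearMap.ext fun η => LinearMap.ext fun ξ => LinearMap.ext fun ε => ?_
  rw [yangBaxterOfLift_apply, yangBaxterOfLift_apply]
  obtain ⟨u, hu, eu⟩ := hmem η
  obtain ⟨v, hv, ev⟩ := hmem ξ
  obtain ⟨w, hw, ew⟩ := hmem ε
  rw [eu, ev, ew]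
  have key : ∀ (α : Dual ℝ (L ⧸ S)) (x y : L), ∀ a ∈ S, ∀ b ∈ S,
      S.mkQ.dualMap α ⁅x + a, y + b⁆ = S.mkQ.dualMap α ⁅x, y⁆ + S.mkQ.dualMap α ⁅a, y⁆
        - S.mkQ.dualMap α ⁅b, x⁆ := by
    intro α x y a ha b hb
    rw [add_lie, lie_add, lie_add, ← lie_skew b x]
    simp only [map_add, map_neg, hz α _ (hS a ha b hb)]
    ring
  rw [key _ _ _ v hv w hw, key _ _ _ w hw u hu, key _ _ _ u hu v hv]
  -- Of the six mixed terms, two contain each of `u`, `v`, `w`; infinitesimal invariance cancels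
  -- each pair.
  linear_combination hinv v hv ε η + hinv w hw η ξ + hinv u hu ξ ε

end LiftIndependence

/-! ### Mixed second derivatives -/

section PartialDerivatives

variable {E₁ E₂ W : Type*} [NormedAddCommGroup E₁] [NormedSpace ℝ E₁]
  [NormedAddCommGroup E₂] [NormedSpace ℝ E₂] [NormedAddCommGroup W] [NormedSpace ℝ W]

theorem eventually_differentiableAt_of_contDiffAt {f : E₁ → W} {x : E₁}
    (hf : ContDiffAt ℝ ∞ f x) : ∀ᶠ y in nhds x, DifferentiableAt ℝ f y := by
  filter_upwards [(hf.of_le (m := 1) (by simp)).eventually (by simp)] with y hy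
  exact hy.differentiableAt (by simp)

theorem fderiv_partial_right {f : E₁ × E₂ → W} {a : E₁} {b : E₂}
    (hf : DifferentiableAt ℝ f (a, b)) :
    fderiv ℝ (fun y => f (a, y)) b = (fderiv ℝ f (a, b)).comp (ContinuousLinearMap.inr ℝ E₁ E₂) :=
  (hf.hasFDerivAt.comp b (hasFDerivAt_prodMk_right a b)).fderiv

theorem fderiv_partial_left {f : E₁ × E₂ → W} {a : E₁} {b : E₂}
    (hf : DifferentiableAt ℝ f (a, b)) :
    fderiv ℝ (fun x => f (x, b)) a = (fderiv ℝ f (a, b)).comp (ContinuousLinearMap.inl ℝ E₁ E₂) :=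
  (hf.hasFDerivAt.comp a (hasFDerivAt_prodMk_left a b)).fderiv

/-- This lemma and its mirror image express both mixed partials by the same value of the second
derivative, so that left and right translations in a Lie group can be compared. -/
theorem hasFDerivAt_fderiv_partial_right {f : E₁ × E₂ → W} {a : E₁} {b : E₂}
    (hf : ContDiffAt ℝ ∞ f (a, b)) :
    ∃ B : E₁ →L[ℝ] E₂ →L[ℝ] W, HasFDerivAt (fun x => fderiv ℝ (fun y => f (x, y)) b) B a ∧
      ∀ u v, B u v = fderiv ℝ (fderiv ℝ f) (a, b) (u, 0) (0, v) := by
  have h2 : HasFDerivAt (fderiv ℝ f) (fderiv ℝ (fderiv ℝ f) (a, b)) (a, b) :=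
    ((hf.fderiv_right (m := ∞) (by simp)).differentiableAt (by simp)).hasFDerivAt
  have h3 := (HasFDerivAt.comp (g := fderiv ℝ f) a h2 (hasFDerivAt_prodMk_left a b)).clm_comp
    (hasFDerivAt_const (ContinuousLinearMap.inr ℝ E₁ E₂) a)
  refine ⟨_, h3.congr_of_eventuallyEq ?_, fun u v => ?_⟩
  · have hc : Filter.Tendsto (fun x : E₁ => (x, b)) (nhds a) (nhds (a, b)) :=
      (Continuous.prodMk_left b).tendsto a
    filter_upwards [hc.eventually (eventually_differentiableAt_of_contDiffAt hf)] with x hx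
    exact fderiv_partial_right hx
  · simp

theorem hasFDerivAt_fderiv_partial_left {f : E₁ × E₂ → W} {a : E₁} {b : E₂}
    (hf : ContDiffAt ℝ ∞ f (a, b)) :
    ∃ B : E₂ →L[ℝ] E₁ →L[ℝ] W, HasFDerivAt (fun y => fderiv ℝ (fun x => f (x, y)) a) B b ∧
      ∀ u v, B v u = fderiv ℝ (fderiv ℝ f) (a, b) (u, 0) (0, v) := by
  have h2 : HasFDerivAt (fderiv ℝ f) (fderiv ℝ (fderiv ℝ f) (a, b)) (a, b) :=
    ((hf.fderiv_right (m := ∞) (by simp)).differentiableAt (by simp)).hasFDerivAt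
  have h3 := (h2.comp b (hasFDerivAt_prodMk_right a b)).clm_comp
    (hasFDerivAt_const (ContinuousLinearMap.inl ℝ E₁ E₂) b)
  refine ⟨_, h3.congr_of_eventuallyEq ?_, fun u v => ?_⟩
  · have hc : Filter.Tendsto (fun y : E₂ => (a, y)) (nhds b) (nhds (a, b)) :=
      (Continuous.prodMk_right a).tendsto b
    filter_upwards [hc.eventually (eventually_differentiableAt_of_contDiffAt hf)] with x hx
    exact fderiv_partial_left hx
  -- Differentiating in the other order gives the arguments swapped; symmetry of the second
  -- derivative restores their order.
  · rw [(hf.isSymmSndFDerivAt (by simpa using ENat.LEInfty.out)).eq (u, 0) (0, v)]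
    simp

end PartialDerivatives

/-! ### Multiplication and translations of a Lie group in the chart at the identity -/

section LieGroupChart

variable (E : Type*) [NormedAddCommGroup E] [NormedSpace ℝ E]
  (G : Type*) [TopologicalSpace G] [ChartedSpace E G] [Group G]

/-- The multiplication of a Lie group, read in the preferred chart at `1`. -/
def chartMul (p : E × E) : E :=
  extChartAt 𝓘(ℝ, E) (1 : G)
    ((extChartAt 𝓘(ℝ, E) (1 : G)).symm p.1 * (extChartAt 𝓘(ℝ, E) (1 : G)).symm p.2)

variable {E G}

/-- The centre `y` of the target chart is kept separate from `f x` because base points such as `a *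
1 * a⁻¹` equal `1` only up to a proof. -/
theorem mfderiv_eq_fderiv_chart {E' : Type*} [NormedAddCommGroup E'] [NormedSpace ℝ E']
    {N : Type*} [TopologicalSpace N] [ChartedSpace E' N] {M : Type*} [TopologicalSpace M]
    [ChartedSpace E M] {f : M → N} {x : M}
    (hf : MDifferentiableAt 𝓘(ℝ, E) 𝓘(ℝ, E') f x) {y : N} (hy : f x = y) :
    (mfderiv 𝓘(ℝ, E) 𝓘(ℝ, E') f x : E →L[ℝ] E') =
      fderiv ℝ (fun z => extChartAt 𝓘(ℝ, E') y (f ((extChartAt 𝓘(ℝ, E) x).symm z)))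
        (extChartAt 𝓘(ℝ, E) x x) := by
  subst hy
  refine hf.mfderiv.trans ?_
  simp only [modelWithCornersSelf_coe, Set.range_id]
  rw [fderivWithin_univ]
  rfl

theorem chartMul_left {x : E} (hx : x ∈ (extChartAt 𝓘(ℝ, E) (1 : G)).target) :
    chartMul E G (extChartAt 𝓘(ℝ, E) (1 : G) 1, x) = x := by
  rw [chartMul, extChartAt_to_inv, one_mul, (extChartAt 𝓘(ℝ, E) (1 : G)).right_inv hx]

theorem chartMul_right {x : E} (hx : x ∈ (extChartAt 𝓘(ℝ, E) (1 : G)).target) :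
    chartMul E G (x, extChartAt 𝓘(ℝ, E) (1 : G) 1) = x := by
  rw [chartMul, extChartAt_to_inv, mul_one, (extChartAt 𝓘(ℝ, E) (1 : G)).right_inv hx]

variable (E G) in
/-- The differential at `1` of the left translation by the point with coordinates `x`. -/
def chartLeft (x : E) : E →L[ℝ] E :=
  fderiv ℝ (fun y => chartMul E G (x, y)) (extChartAt 𝓘(ℝ, E) (1 : G) 1)

variable (E G) in
/-- The differential at `1` of the right translation by the point with coordinates `x`. -/
def chartRight (y : E) : E →L[ℝ] E :=
  fderiv ℝ (fun x => chartMul E G (x, y)) (extChartAt 𝓘(ℝ, E) (1 : G) 1)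

theorem chartLeft_one :
    chartLeft E G (extChartAt 𝓘(ℝ, E) (1 : G) 1) = ContinuousLinearMap.id ℝ E := by
  refine (Filter.EventuallyEq.fderiv_eq ?_).trans fderiv_id
  filter_upwards [extChartAt_target_mem_nhds (I := 𝓘(ℝ, E)) (1 : G)] with x hx
  exact chartMul_left hx

theorem chartRight_one :
    chartRight E G (extChartAt 𝓘(ℝ, E) (1 : G) 1) = ContinuousLinearMap.id ℝ E := by
  refine (Filter.EventuallyEq.fderiv_eq ?_).trans fderiv_id
  filter_upwards [extChartAt_target_mem_nhds (I := 𝓘(ℝ, E)) (1 : G)] with x hx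
  exact chartMul_right hx

variable [LieGroup 𝓘(ℝ, E) ∞ G]

theorem contMDiffAt_chart_symm_mul_chart_symm :
    ContMDiffAt 𝓘(ℝ, E × E) 𝓘(ℝ, E) ∞ (fun p : E × E =>
      (extChartAt 𝓘(ℝ, E) (1 : G)).symm p.1 * (extChartAt 𝓘(ℝ, E) (1 : G)).symm p.2)
      (extChartAt 𝓘(ℝ, E) (1 : G) 1, extChartAt 𝓘(ℝ, E) (1 : G) 1) := by
  have h : ContMDiffAt 𝓘(ℝ, E) 𝓘(ℝ, E) ∞ (extChartAt 𝓘(ℝ, E) (1 : G)).symm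
      (extChartAt 𝓘(ℝ, E) (1 : G) 1) :=
    (contMDiffOn_extChartAt_symm (1 : G)).contMDiffAt (extChartAt_target_mem_nhds (1 : G))
  exact (ContMDiffAt.comp (_, _) h contDiff_fst.contDiffAt.contMDiffAt).mul
    (ContMDiffAt.comp (_, _) h contDiff_snd.contDiffAt.contMDiffAt)

theorem contDiffAt_comp_chart_symm_mul {W : Type*} [NormedAddCommGroup W] [NormedSpace ℝ W]
    {f : G → W} (hf : ContMDiffAt 𝓘(ℝ, E) 𝓘(ℝ, W) ∞ f 1) :
    ContDiffAt ℝ ∞ (fun p : E × E => f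
      ((extChartAt 𝓘(ℝ, E) (1 : G)).symm p.1 * (extChartAt 𝓘(ℝ, E) (1 : G)).symm p.2))
      (extChartAt 𝓘(ℝ, E) (1 : G) 1, extChartAt 𝓘(ℝ, E) (1 : G) 1) := by
  refine ContMDiffAt.contDiffAt ?_
  refine ContMDiffAt.comp (_, _) ?_ (contMDiffAt_chart_symm_mul_chart_symm (G := G))
  simpa using hf

theorem contDiffAt_chartMul :
    ContDiffAt ℝ ∞ (chartMul E G)
      (extChartAt 𝓘(ℝ, E) (1 : G) 1, extChartAt 𝓘(ℝ, E) (1 : G) 1) :=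
  contDiffAt_comp_chart_symm_mul contMDiffAt_extChartAt

-- Both derivatives are the mixed second derivative of the multiplication at the identity, whose
-- antisymmetrisation is the Lie bracket.
variable (E G) in
theorem exists_hasFDerivAt_chartLeft_chartRight :
    ∃ B B' : E →L[ℝ] E →L[ℝ] E,
      HasFDerivAt (chartLeft E G) B (extChartAt 𝓘(ℝ, E) (1 : G) 1) ∧
      HasFDerivAt (chartRight E G) B' (extChartAt 𝓘(ℝ, E) (1 : G) 1) ∧
      ∀ u v, B' v u = B u v := by
  obtain ⟨B, hB, hB'⟩ := hasFDerivAt_fderiv_partial_right (contDiffAt_chartMul (E := E) (G := G))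
  obtain ⟨C, hC, hC'⟩ := hasFDerivAt_fderiv_partial_left (contDiffAt_chartMul (E := E) (G := G))
  exact ⟨B, C, hB, hC, fun u v => (hC' u v).trans (hB' u v).symm⟩

/-- The left-invariant vector field of `v`, read in the chart at `1`. -/
theorem mfderiv_chart_mulInvariantVectorField {b : G}
    (hb : b ∈ (extChartAt 𝓘(ℝ, E) (1 : G)).source) (v : E) :
    (mfderiv 𝓘(ℝ, E) 𝓘(ℝ, E) (extChartAt 𝓘(ℝ, E) (1 : G)) b : E →L[ℝ] E)
      (mulInvariantVectorField (I := 𝓘(ℝ, E)) (G := G) v b : E) =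
      chartLeft E G (extChartAt 𝓘(ℝ, E) (1 : G) b) v := by
  have h1 : MDifferentiableAt 𝓘(ℝ, E) 𝓘(ℝ, E) (fun x : G => b * x) 1 :=
    (contMDiff_mul_left (n := ∞)).mdifferentiableAt (by simp)
  have h2 : MDifferentiableAt 𝓘(ℝ, E) 𝓘(ℝ, E) (extChartAt 𝓘(ℝ, E) (1 : G)) (b * 1) := by
    rw [mul_one]
    exact mdifferentiableAt_extChartAt (by simpa using hb)
  have h3 : (mfderiv 𝓘(ℝ, E) 𝓘(ℝ, E) (extChartAt 𝓘(ℝ, E) (1 : G)) b : E →L[ℝ] E) =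
      (mfderiv 𝓘(ℝ, E) 𝓘(ℝ, E) (extChartAt 𝓘(ℝ, E) (1 : G)) (b * 1) : E →L[ℝ] E) := by
    rw [mul_one]
  have h4 := mfderiv_eq_fderiv_chart (h2.comp (1 : G) h1) rfl
  have h5 : (mfderiv 𝓘(ℝ, E) 𝓘(ℝ, E) (extChartAt 𝓘(ℝ, E) (1 : G) ∘ fun x : G => b * x) 1 :
      E →L[ℝ] E) = _ := mfderiv_comp (1 : G) h2 h1
  rw [h3]
  refine (DFunLike.congr_fun (h5.symm.trans h4) v).trans ?_
  simp only [chartLeft, chartMul, (extChartAt 𝓘(ℝ, E) (1 : G)).left_inv hb]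
  rfl

end LieGroupChart

/-! ### Two tools for differentiating forms and families of operators -/

section ContinuousForm

variable {E : Type*} [NormedAddCommGroup E] [NormedSpace ℝ E] [FiniteDimensional ℝ E]

/-- In finite dimension linear maps are continuous; this allows a bivector to be differentiated
along a moving pair of covectors. -/
theorem Bivector.exists_continuous_form (r : Bivector E) :
    ∃ R : (E →L[ℝ] ℝ) →L[ℝ] (E →L[ℝ] ℝ) →L[ℝ] ℝ,
      ∀ α β : E →L[ℝ] ℝ, R α β = r.form α.toLinearMap β.toLinearMap := by
  let J : (E →L[ℝ] ℝ) →ₗ[ℝ] Dual ℝ E :=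
    (LinearMap.toContinuousLinearMap (𝕜 := ℝ) (E := E) (F' := ℝ)).symm.toLinearMap
  exact ⟨LinearMap.toContinuousLinearMap
    ((LinearMap.toContinuousLinearMap (𝕜 := ℝ) (E := E →L[ℝ] ℝ) (F' := ℝ)).toLinearMap ∘ₗ
      r.form.compl₁₂ J J), fun _ _ => rfl⟩

end ContinuousForm

section InverseComp

variable {X E : Type*} [NormedAddCommGroup X] [NormedSpace ℝ X]
  [NormedAddCommGroup E] [NormedSpace ℝ E] [CompleteSpace E]

/-- The derivative of inversion at the identity is `-id`. The application is `Ad`, which near the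
identity is a left translation corrected by an inverse right translation. -/
theorem hasFDerivAt_inverse_comp {R T : X → E →L[ℝ] E} {x : X} {R' T' : X →L[ℝ] E →L[ℝ] E}
    (hR1 : R x = ContinuousLinearMap.id ℝ E) (hT1 : T x = ContinuousLinearMap.id ℝ E)
    (hR : HasFDerivAt R R' x) (hT : HasFDerivAt T T' x) :
    HasFDerivAt (fun y => (Ring.inverse (R y)).comp (T y)) (T' - R') x := by
  have hinv := hasFDerivAt_ringInverse (𝕜 := ℝ) (1 : (E →L[ℝ] E)ˣ)
  have hR1' : R x = ((1 : (E →L[ℝ] E)ˣ) : E →L[ℝ] E) := hR1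
  rw [← hR1'] at hinv
  have hmain := HasFDerivAt.clm_comp (HasFDerivAt.comp x hinv hR) hT
  refine hmain.congr_fderiv ?_
  ext u v
  have h1 : Ring.inverse (ContinuousLinearMap.id ℝ E) = ContinuousLinearMap.id ℝ E :=
    Ring.inverse_one (E →L[ℝ] E)
  simp [hR1, hT1, h1, sub_eq_add_neg]

end InverseComp

/-! ### The Lie bracket, second left derivatives and the derivative of `Ad` -/

section LieGroupBracket

variable {E : Type*} [NormedAddCommGroup E] [NormedSpace ℝ E]
  {G : Type*} [TopologicalSpace G] [ChartedSpace E G] [Group G]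

variable (E) in
/-- The derivatives at `b` of a function along the left-invariant vector fields. -/
def leftDeriv (f : G → ℝ) (b : G) : E →L[ℝ] ℝ :=
  mfderiv 𝓘(ℝ, E) 𝓘(ℝ, ℝ) (fun x => f (b * x)) 1

/-- Associativity alone; it reduces computations at `a` to computations at `1`. -/
theorem leftDeriv_mul_left (f : G → ℝ) (a b : G) :
    leftDeriv E (fun x => f (a * x)) b = leftDeriv E f (a * b) := by
  have h : (fun x => f (a * (b * x))) = fun x => f (a * b * x) := by simp only [mul_assoc]
  let d : (G → ℝ) → E →L[ℝ] ℝ := fun k => mfderiv 𝓘(ℝ, E) 𝓘(ℝ, ℝ) k 1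
  exact congrArg d h

variable [LieGroup 𝓘(ℝ, E) ∞ G]

open VectorField in
/-- The Lie bracket in terms of the derivative of left translations in the chart at `1`. -/
theorem bracket_eq_of_hasFDerivAt_chartLeft {B : E →L[ℝ] E →L[ℝ] E}
    (hB : HasFDerivAt (chartLeft E G) B (extChartAt 𝓘(ℝ, E) (1 : G) 1)) 
    (u v : GroupLieAlgebra 𝓘(ℝ, E) G) : (⁅u, v⁆ : GroupLieAlgebra 𝓘(ℝ, E) G) = B u v - B v u := by
  -- In the chart the left-invariant field of `w` is `x ↦ chartLeft E G x w`, with value `w` and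
  -- derivative `B.flip w` at the identity; the bracket formula on a vector space then gives `B u v
  -- - B v u`.
  have hpull : ∀ w : E, (mpullbackWithin 𝓘(ℝ, E) 𝓘(ℝ, E) (extChartAt 𝓘(ℝ, E) (1 : G)).symm
      (mulInvariantVectorField (I := 𝓘(ℝ, E)) (G := G) w) (Set.range 𝓘(ℝ, E)) : E → E)
      =ᶠ[nhds (extChartAt 𝓘(ℝ, E) (1 : G) 1)] fun x => chartLeft E G x w := by
    intro w
    filter_upwards [extChartAt_target_mem_nhds (I := 𝓘(ℝ, E)) (1 : G)] with x hx
    have h1 := ContinuousLinearMap.inverse_eq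
      (mfderivWithin_extChartAt_symm_comp_mfderiv_extChartAt (I := 𝓘(ℝ, E)) hx)
      (mfderiv_extChartAt_comp_mfderivWithin_extChartAt_symm (I := 𝓘(ℝ, E)) hx)
    have h2 := mfderiv_chart_mulInvariantVectorField (E := E)
      ((extChartAt 𝓘(ℝ, E) (1 : G)).map_target hx) w
    rw [(extChartAt 𝓘(ℝ, E) (1 : G)).right_inv hx] at h2
    exact (DFunLike.congr_fun h1 _).trans h2
  have hd : ∀ w : E, HasFDerivAt (fun x => chartLeft E G x w) (B.flip w)
      (extChartAt 𝓘(ℝ, E) (1 : G) 1) := fun w =>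
    (hB.clm_apply (hasFDerivAt_const w _)).congr_fderiv (by ext; simp)
  have h0 : lieBracket ℝ (fun x => chartLeft E G x u) (fun x => chartLeft E G x v)
      (extChartAt 𝓘(ℝ, E) (1 : G) 1) = B u v - B v u := by
    rw [lieBracket, (hd u).fderiv, (hd v).fderiv, chartLeft_one]
    rfl
  rw [← h0, ← (hpull u).lieBracket_vectorField_eq (hpull v)]
  rw [GroupLieAlgebra.bracket_def, ← mlieBracketWithin_univ]
  refine mlieBracketWithin_apply.trans ?_
  -- The chart has identity differential at its own centre, so carrying the bracket back to the
  -- group changes nothing.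
  have hid : ∀ w : E, (mfderiv 𝓘(ℝ, E) 𝓘(ℝ, E) (extChartAt 𝓘(ℝ, E) (1 : G)) 1 :
      E →L[ℝ] E).inverse w = w := by
    have h : (mfderiv 𝓘(ℝ, E) 𝓘(ℝ, E) (extChartAt 𝓘(ℝ, E) (1 : G)) 1 : E →L[ℝ] E) =
      ContinuousLinearMap.id ℝ E := mfderiv_extChartAt_self
    intro w
    refine (DFunLike.congr_fun (congrArg ContinuousLinearMap.inverse h) w).trans ?_
    exact DFunLike.congr_fun (ContinuousLinearMap.inverse_id (R := ℝ) (M := E)) w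
  refine (hid _).trans ?_
  simp only [Set.preimage_univ, Set.univ_inter, modelWithCornersSelf_coe, Set.range_id]
  exact congrFun (lieBracketWithin_univ (E := E)) _

/-- The second derivatives of a smooth function along left-invariant vector fields commute up to
the Lie bracket. -/
theorem exists_hasMFDerivAt_leftDeriv {f : G → ℝ}
    (hf : ContMDiffAt 𝓘(ℝ, E) 𝓘(ℝ, ℝ) ∞ f 1) :
    ∃ B : E →L[ℝ] E →L[ℝ] ℝ,
      HasMFDerivAt 𝓘(ℝ, E) 𝓘(ℝ, E →L[ℝ] ℝ)
        (leftDeriv E f) 1 B ∧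
      ∀ u v : GroupLieAlgebra 𝓘(ℝ, E) G, B u v - B v u =
        leftDeriv E f 1 (⁅u, v⁆ : GroupLieAlgebra 𝓘(ℝ, E) G) := by
  have := topologicalGroup_of_lieGroup (G := G) 𝓘(ℝ, E) ∞
  set e : E := extChartAt 𝓘(ℝ, E) (1 : G) 1 with he
  obtain ⟨C, -, hC, -, -⟩ := exists_hasFDerivAt_chartLeft_chartRight E G
  have hΨ := contDiffAt_comp_chart_symm_mul hf
  set fc : E → ℝ := fun x => f ((extChartAt 𝓘(ℝ, E) (1 : G)).symm x) with hfc
  have hfcs : ContDiffAt ℝ ∞ fc e := by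
    have h := ContDiffAt.comp (f := fun x => (x, e)) e hΨ (contDiffAt_id.prodMk contDiffAt_const)
    refine h.congr_of_eventuallyEq (Filter.Eventually.of_forall fun x => ?_)
    simp [hfc, he]
  have hmulc : ContDiffAt ℝ ∞ (chartMul E G) (e, e) := contDiffAt_chartMul
  obtain ⟨D, hD⟩ : ∃ D, HasFDerivAt (fderiv ℝ fc) D e :=
    ⟨_, ((hfcs.fderiv_right (m := ∞) (by simp)).differentiableAt (by simp)).hasFDerivAt⟩
  -- The coordinate Hessian is symmetric and drops out of the antisymmetrisation; only the
  -- derivative of `chartLeft` survives, which yields the bracket.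
  have hDsymm : ∀ u v, D u v = D v u := by
    intro u v
    have h := (hfcs.isSymmSndFDerivAt (by simpa using ENat.LEInfty.out)).eq u v
    rwa [hD.fderiv] at h
  -- the derivative along left-invariant fields, in the chart
  have hloc : ∀ᶠ b in nhds (1 : G),
      leftDeriv E f b = (fderiv ℝ fc (extChartAt 𝓘(ℝ, E) (1 : G) b)).comp
          (chartLeft E G (extChartAt 𝓘(ℝ, E) (1 : G) b)) := by
    have hcont : ContinuousAt (extChartAt 𝓘(ℝ, E) (1 : G)) 1 := continuousAt_extChartAt 1
    have hpair : Filter.Tendsto (fun x : E => (x, e)) (nhds e) (nhds (e, e)) :=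
      (Continuous.prodMk_left e).tendsto e
    filter_upwards [extChartAt_source_mem_nhds (I := 𝓘(ℝ, E)) (1 : G),
      hcont.eventually (extChartAt_target_mem_nhds (I := 𝓘(ℝ, E)) (1 : G)),
      hcont.eventually (eventually_differentiableAt_of_contDiffAt hfcs),
      hcont.eventually (hpair.eventually (eventually_differentiableAt_of_contDiffAt hmulc)),
      (contMDiffAt_iff_contMDiffAt_nhds (by simp)).1 (hf.of_le (by simp : (1 : WithTop ℕ∞) ≤ ∞))]
      with b hb hbt hbf hbm hbs
    have h1 : MDifferentiableAt 𝓘(ℝ, E) 𝓘(ℝ, ℝ) (fun x => f (b * x)) 1 := by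
      have h2 : MDifferentiableAt 𝓘(ℝ, E) 𝓘(ℝ, ℝ) f (b * 1) := by
        rw [mul_one]
        exact hbs.mdifferentiableAt (by simp)
      exact h2.comp (1 : G) ((contMDiff_mul_left (n := ∞)).mdifferentiableAt (by simp))
    refine (mfderiv_eq_fderiv_chart h1 rfl).trans ?_
    have h3 : DifferentiableAt ℝ (fun y => chartMul E G (extChartAt 𝓘(ℝ, E) (1 : G) b, y)) e :=
      DifferentiableAt.comp (g := chartMul E G) e hbm (hasFDerivAt_prodMk_right _ _).differentiableAt
    rw [← chartMul_right hbt] at hbf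
    have h4 := hbf.hasFDerivAt.comp e h3.hasFDerivAt
    rw [chartMul_right hbt] at h4
    rw [chartLeft, ← h4.fderiv]
    refine Filter.EventuallyEq.fderiv_eq ?_
    have h5 : ContinuousAt (fun y => b * (extChartAt 𝓘(ℝ, E) (1 : G)).symm y) e :=
      continuousAt_const.mul (continuousAt_extChartAt_symm (1 : G))
    have h6 : b * (extChartAt 𝓘(ℝ, E) (1 : G)).symm e ∈ (extChartAt 𝓘(ℝ, E) (1 : G)).source := by
      rwa [he, extChartAt_to_inv, mul_one]
    filter_upwards [h5.preimage_mem_nhds ((isOpen_extChartAt_source (1 : G)).mem_nhds h6)]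
      with y hy
    simp only [hfc, Function.comp_apply, chartMul, (extChartAt 𝓘(ℝ, E) (1 : G)).left_inv hb]
    rw [(extChartAt 𝓘(ℝ, E) (1 : G)).left_inv hy]
    rfl
  have hDC := (hD.clm_comp hC)
  refine ⟨_, HasMFDerivAt.congr_of_eventuallyEq (?_ : HasMFDerivAt 𝓘(ℝ, E) 𝓘(ℝ, E →L[ℝ] ℝ)
    ((fun x => (fderiv ℝ fc x).comp (chartLeft E G x)) ∘ extChartAt 𝓘(ℝ, E) (1 : G)) 1
    (((ContinuousLinearMap.compL ℝ E E ℝ) (fderiv ℝ fc e)).comp C +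
      ((ContinuousLinearMap.compL ℝ E E ℝ).flip (chartLeft E G e)).comp D)) hloc, ?_⟩
  · have h := (hDC.hasMFDerivAt).comp (1 : G)
      (mdifferentiableAt_extChartAt (I := 𝓘(ℝ, E)) (mem_chart_source E (1 : G))).hasMFDerivAt
    rw [mfderiv_extChartAt_self] at h
    exact h
  · intro u v
    have h1 : leftDeriv E f 1 = fderiv ℝ fc e := by
      rw [hloc.self_of_nhds, chartLeft_one, ContinuousLinearMap.comp_id]
    rw [h1, bracket_eq_of_hasFDerivAt_chartLeft hC, map_sub]
    have h2 : ∀ u v : E, (((ContinuousLinearMap.compL ℝ E E ℝ) (fderiv ℝ fc e)).comp C +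
      ((ContinuousLinearMap.compL ℝ E E ℝ).flip (chartLeft E G e)).comp D) u v =
        fderiv ℝ fc e (C u v) + D u v := by
      intro u v
      have h3 : chartLeft E G e v = v := DFunLike.congr_fun chartLeft_one v
      simp [h3]
    erw [h2, h2, hDsymm u v]
    ring

/-- `Ad_a` as a continuous linear map of the model space. -/
def AdL (E : Type*) [NormedAddCommGroup E] [NormedSpace ℝ E]
    {G : Type*} [TopologicalSpace G] [ChartedSpace E G] [Group G] (a : G) : E →L[ℝ] E :=
  mfderiv 𝓘(ℝ, E) 𝓘(ℝ, E) (fun g : G => a * g * a⁻¹) 1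

/-- The differential at `1` of the adjoint representation of a Lie group is the adjoint
representation of its Lie algebra. -/
theorem exists_hasDerivAt_AdL [CompleteSpace E] {c : ℝ → G} (hc : c 0 = 1)
    {u : GroupLieAlgebra 𝓘(ℝ, E) G}
    (hcu : HasMFDerivAt 𝓘(ℝ, ℝ) 𝓘(ℝ, E) c 0 (ContinuousLinearMap.toSpanSingleton ℝ (u : E))) :
    ∃ D : E →L[ℝ] E, HasDerivAt (fun t => AdL E (c t)) D 0 ∧
      ∀ v : GroupLieAlgebra 𝓘(ℝ, E) G, D v = (⁅u, v⁆ : GroupLieAlgebra 𝓘(ℝ, E) G) := by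
  have := topologicalGroup_of_lieGroup (G := G) 𝓘(ℝ, E) ∞
  set e : E := extChartAt 𝓘(ℝ, E) (1 : G) 1 with he
  let u' : E := u
  obtain ⟨B, B', hB, hB', hBB'⟩ := exists_hasFDerivAt_chartLeft_chartRight E G
  have hmulc : ContDiffAt ℝ ∞ (chartMul E G) (e, e) := contDiffAt_chartMul
  have hconj : ∀ a : G, ContMDiff 𝓘(ℝ, E) 𝓘(ℝ, E) ∞ (fun g : G => a * g * a⁻¹) := fun a =>
    ((contMDiff_const (c := a)).mul contMDiff_id).mul (contMDiff_const (c := a⁻¹))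
  -- The identity `(a g a⁻¹) a = a g`, differentiated at `g = 1`. It gives `Ad_a` as an inverse
  -- right translation followed after a left one, without differentiating `a ↦ a⁻¹`.
  have hloc : ∀ᶠ a in nhds (1 : G), ∀ w : E,
      chartRight E G (extChartAt 𝓘(ℝ, E) (1 : G) a) (AdL E a w) =
        chartLeft E G (extChartAt 𝓘(ℝ, E) (1 : G) a) w := by
    have hcont : ContinuousAt (extChartAt 𝓘(ℝ, E) (1 : G)) 1 := continuousAt_extChartAt 1
    have hpair : Filter.Tendsto (fun x : E => (e, x)) (nhds e) (nhds (e, e)) :=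
      (Continuous.prodMk_right e).tendsto e
    filter_upwards [extChartAt_source_mem_nhds (I := 𝓘(ℝ, E)) (1 : G),
      hcont.eventually (hpair.eventually (eventually_differentiableAt_of_contDiffAt hmulc))]
      with a ha ham w
    set K : E → E := fun y => extChartAt 𝓘(ℝ, E) (1 : G)
      (a * (extChartAt 𝓘(ℝ, E) (1 : G)).symm y * a⁻¹) with hK
    have hKe : K e = e := by simp [hK, he]
    have hKd : DifferentiableAt ℝ K e := by
      have h1 : ContMDiffAt 𝓘(ℝ, E) 𝓘(ℝ, E) ∞ (extChartAt 𝓘(ℝ, E) (1 : G)).symm e :=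
        (contMDiffOn_extChartAt_symm (1 : G)).contMDiffAt (extChartAt_target_mem_nhds (1 : G))
      have h2 : ContMDiffAt 𝓘(ℝ, E) 𝓘(ℝ, E) ∞ K e := by
        refine ContMDiffAt.comp e ?_ ((hconj a).contMDiffAt.comp e h1)
        have : a * (extChartAt 𝓘(ℝ, E) (1 : G)).symm e * a⁻¹ = 1 := by simp [he]
        simp only [this]
        exact contMDiffAt_extChartAt
      exact h2.contDiffAt.differentiableAt (by simp)
    have hAd : ∀ w : E, AdL E a w = fderiv ℝ K e w := fun w => DFunLike.congr_fun
      (mfderiv_eq_fderiv_chart ((hconj a).mdifferentiableAt (by simp)) (by simp)) w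
    have hR : DifferentiableAt ℝ
        (fun x => chartMul E G (x, extChartAt 𝓘(ℝ, E) (1 : G) a)) (K e) := by
      rw [hKe]
      exact DifferentiableAt.comp (g := chartMul E G) e ham (hasFDerivAt_prodMk_left _ _).differentiableAt
    have h4 := hR.hasFDerivAt.comp e hKd.hasFDerivAt
    have h5 : (fun x => chartMul E G (x, extChartAt 𝓘(ℝ, E) (1 : G) a)) ∘ K =ᶠ[nhds e]
        fun y => chartMul E G (extChartAt 𝓘(ℝ, E) (1 : G) a, y) := by
      have h6 : ContinuousAt (fun y => a * (extChartAt 𝓘(ℝ, E) (1 : G)).symm y * a⁻¹) e :=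
        (continuousAt_const.mul (continuousAt_extChartAt_symm (1 : G))).mul continuousAt_const
      have h7 : a * (extChartAt 𝓘(ℝ, E) (1 : G)).symm e * a⁻¹ ∈
          (extChartAt 𝓘(ℝ, E) (1 : G)).source := by simp [he]
      filter_upwards [h6.preimage_mem_nhds ((isOpen_extChartAt_source (1 : G)).mem_nhds h7)]
        with y hy
      simp only [hK, Function.comp_apply, chartMul, (extChartAt 𝓘(ℝ, E) (1 : G)).left_inv ha]
      rw [(extChartAt 𝓘(ℝ, E) (1 : G)).left_inv hy, inv_mul_cancel_right]
    have h8 : (fderiv ℝ (fun x => chartMul E G (x, extChartAt 𝓘(ℝ, E) (1 : G) a)) e).comp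
        (fderiv ℝ K e) = chartLeft E G (extChartAt 𝓘(ℝ, E) (1 : G) a) := by
      have h9 := h4.fderiv.symm.trans h5.fderiv_eq
      rwa [hKe] at h9
    rw [hAd]
    exact congrArg (fun A : E →L[ℝ] E => A w) h8
  set γ : ℝ → E := fun t => extChartAt 𝓘(ℝ, E) (1 : G) (c t) with hγ
  have hγ0 : γ 0 = e := by simp [hγ, hc, he]
  have hγd : HasDerivAt γ u' 0 := by
    obtain ⟨A, hA, hA1⟩ : ∃ A : E →L[ℝ] E, HasMFDerivAt 𝓘(ℝ, E) 𝓘(ℝ, E)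
        (extChartAt 𝓘(ℝ, E) (1 : G)) (c 0) A ∧ A = ContinuousLinearMap.id ℝ E := by
      rw [hc]
      exact ⟨_, (mdifferentiableAt_extChartAt (mem_chart_source E (1 : G))).hasMFDerivAt,
        mfderiv_extChartAt_self⟩
    have h3 : HasFDerivAt γ (A.comp (ContinuousLinearMap.toSpanSingleton ℝ u')) 0 :=
      (hA.comp (0 : ℝ) hcu).hasFDerivAt
    simpa [hA1] using h3.hasDerivAt
  have hcont : Filter.Tendsto c (nhds 0) (nhds 1) := by
    have h := hcu.continuousAt.tendsto
    rwa [hc] at h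
  have hγc : Filter.Tendsto γ (nhds 0) (nhds e) := by
    have h := hγd.continuousAt.tendsto
    rwa [hγ0] at h
  have hR1 : chartRight E G e = ((1 : (E →L[ℝ] E)ˣ) : E →L[ℝ] E) := chartRight_one
  have hmain := hasFDerivAt_inverse_comp chartRight_one chartLeft_one hB' hB
  rw [← he, ← hγ0] at hmain
  have hmain' := hmain.comp_hasDerivAt 0 hγd
  -- Invertible operators form a neighbourhood of the identity, so right translations stay
  -- invertible for small `t`.
  have hunit : ∀ᶠ t in nhds (0 : ℝ), IsUnit (chartRight E G (γ t)) := by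
    refine (hB'.continuousAt.tendsto.comp hγc).eventually ?_
    rw [hR1]
    exact Units.nhds 1
  -- Since `B' u v = B v u`, this operator sends `v` to `B u v - B v u`, the bracket.
  refine ⟨(B - B') u', hmain'.congr_of_eventuallyEq ?_, fun v => ?_⟩
  · filter_upwards [hunit, hcont.eventually hloc] with t ht hlt
    ext v
    have h1 := congrArg (fun A : E →L[ℝ] E => A (AdL E (c t) v))
      (Ring.inverse_mul_cancel (chartRight E G (γ t)) ht)
    refine h1.symm.trans ?_
    exact congrArg (fun w : E => (Ring.inverse (chartRight E G (γ t)) : E →L[ℝ] E) w) (hlt v)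
  · rw [bracket_eq_of_hasFDerivAt_chartLeft hB]
    let v' : E := v
    exact congrArg (fun w : E => B u' v' - w) (hBB' v' u')

end LieGroupBracket

/-! ### Local sections of submersions and curves in their fibres -/

section Submersion

variable {E : Type*} [NormedAddCommGroup E] [NormedSpace ℝ E]
  {F : Type*} [NormedAddCommGroup F] [NormedSpace ℝ F]
  {M : Type*} [TopologicalSpace M] [ChartedSpace E M]
  {N : Type*} [TopologicalSpace N] [ChartedSpace F N]

/-- A submersion has smooth local sections. -/
theorem Manifold.IsSubmersionAt.exists_section {f : M → N} {x : M}
    (h : Manifold.IsSubmersionAt 𝓘(ℝ, E) 𝓘(ℝ, F) ∞ f x) :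
    ∃ s : N → M, s (f x) = x ∧ ContMDiffAt 𝓘(ℝ, F) 𝓘(ℝ, E) ∞ s (f x) ∧
      ∀ᶠ y in nhds (f x), f (s y) = y := by
  have hw : ∀ z ∈ h.domChart.target, h.codChart (f (h.domChart.symm z)) = (h.equiv z).1 := by
    intro z hz
    exact h.writtenInCharts (by simpa using hz)
  have hx := h.mem_domChart_source
  have hfx := h.mem_codChart_source
  set φ := h.domChart with hφ
  set ψ := h.codChart with hψ
  set L := h.equiv
  have h1 : L.symm (ψ (f x), (L (φ x)).2) = φ x := by
    have h2 := hw (φ x) (φ.map_source hx)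
    rw [φ.left_inv hx] at h2
    rw [h2, Prod.mk.eta, L.symm_apply_apply]
  have hψs : ContMDiffAt 𝓘(ℝ, F) 𝓘(ℝ, F) ∞ ψ (f x) :=
    contMDiffAt_of_mem_maximalAtlas h.codChart_mem_maximalAtlas hfx
  have hz : ContMDiffAt 𝓘(ℝ, F) 𝓘(ℝ, E) ∞ (fun y => L.symm (ψ y, (L (φ x)).2)) (f x) := by
    have h3 : ContDiff ℝ ∞ (fun w : F => L.symm (w, (L (φ x)).2)) := by fun_prop
    exact ContMDiffAt.comp (g := fun w : F => L.symm (w, (L (φ x)).2)) (f x)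
      h3.contMDiff.contMDiffAt hψs
  -- In adapted charts `f` is the first projection; the section freezes the complementary coordinate
  -- at its value at `x`.
  refine ⟨fun y => φ.symm (L.symm (ψ y, (L (φ x)).2)), ?_, ?_, ?_⟩
  · simp only [h1, φ.left_inv hx]
  · refine ContMDiffAt.comp (f x) ?_ hz
    simp only [h1]
    exact contMDiffAt_symm_of_mem_maximalAtlas h.domChart_mem_maximalAtlas (φ.map_source hx)
  · have h4 := hz.continuousAt.preimage_mem_nhds (φ.open_target.mem_nhds
      (by simp only [h1]; exact φ.map_source hx))
    filter_upwards [h4, ψ.open_source.mem_nhds hfx] with y hy hys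
    refine ψ.injOn (h.source_subset_preimage_source (φ.map_target hy)) hys ?_
    rw [hw _ hy, L.apply_symm_apply]

/-- Every vector in the kernel of the differential of a submersion is the velocity of a curve in
the fibre. -/
theorem Manifold.IsSubmersionAt.exists_curve_in_fiber {f : M → N} {x : M}
    (h : Manifold.IsSubmersionAt 𝓘(ℝ, E) 𝓘(ℝ, F) ∞ f x) (u : E)
    (hu : (mfderiv 𝓘(ℝ, E) 𝓘(ℝ, F) f x : E →L[ℝ] F) u = 0) :
    ∃ c : ℝ → M, c 0 = x ∧ (∀ t, f (c t) = f x) ∧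
      HasMFDerivAt 𝓘(ℝ, ℝ) 𝓘(ℝ, E) c 0 (ContinuousLinearMap.toSpanSingleton ℝ u) := by
  classical
  have hw : ∀ z ∈ h.domChart.target, h.codChart (f (h.domChart.symm z)) = (h.equiv z).1 := by
    intro z hz
    exact h.writtenInCharts (by simpa using hz)
  have hx := h.mem_domChart_source
  have hfx := h.mem_codChart_source
  set φ := h.domChart with hφ
  set ψ := h.codChart with hψ
  set L := h.equiv
  obtain ⟨A, hA⟩ : ∃ A : E →L[ℝ] E, HasMFDerivAt 𝓘(ℝ, E) 𝓘(ℝ, E) φ x A :=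
    ⟨_, ((contMDiffAt_of_mem_maximalAtlas h.domChart_mem_maximalAtlas hx).mdifferentiableAt
      (by simp)).hasMFDerivAt⟩
  obtain ⟨A', hA'⟩ : ∃ A' : E →L[ℝ] E, HasMFDerivAt 𝓘(ℝ, E) 𝓘(ℝ, E) φ.symm (φ x) A' :=
    ⟨_, ((contMDiffAt_symm_of_mem_maximalAtlas h.domChart_mem_maximalAtlas
      (φ.map_source hx)).mdifferentiableAt (by simp)).hasMFDerivAt⟩
  obtain ⟨B, hB⟩ : ∃ B : F →L[ℝ] F, HasMFDerivAt 𝓘(ℝ, F) 𝓘(ℝ, F) ψ (f x) B :=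
    ⟨_, ((contMDiffAt_of_mem_maximalAtlas h.codChart_mem_maximalAtlas hfx).mdifferentiableAt
      (by simp)).hasMFDerivAt⟩
  have hAA' : A'.comp A = ContinuousLinearMap.id ℝ E := by
    have h1 := (hA'.comp x hA).congr_of_eventuallyEq (f₁ := id) (by
      filter_upwards [φ.open_source.mem_nhds hx] with y hy
      exact (φ.left_inv hy).symm)
    exact hasMFDerivAt_unique h1 (hasMFDerivAt_id x)
  -- In adapted charts a kernel vector has no component along the base: differentiate `ψ ∘ f = fst ∘
  -- L ∘ φ` at `x`.
  have hLA : (L (A u)).1 = 0 := by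
    have h1 : HasMFDerivAt 𝓘(ℝ, E) 𝓘(ℝ, F) (fun y => (L (φ y)).1) x
        (((ContinuousLinearMap.fst ℝ F h.complement).comp (L : E →L[ℝ] F × h.complement)).comp A) :=
      (((ContinuousLinearMap.fst ℝ F h.complement).comp
        (L : E →L[ℝ] F × h.complement)).hasFDerivAt.hasMFDerivAt).comp x hA
    have h2 := (hB.comp x (h.contMDiffAt.mdifferentiableAt (by simp)).hasMFDerivAt)
    have h3 := h1.congr_of_eventuallyEq (f₁ := ψ ∘ f) (by
      filter_upwards [φ.open_source.mem_nhds hx] with y hy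
      have h4 := hw (φ y) (φ.map_source hy)
      rwa [φ.left_inv hy] at h4)
    have h5 := congrArg (fun C : E →L[ℝ] F => C u) (hasMFDerivAt_unique h3 h2)
    refine h5.trans ?_
    exact (congrArg B hu).trans (map_zero B)
  have hline : HasDerivAt (fun t : ℝ => φ x + t • A u) (A u) 0 := by
    simpa using ((hasDerivAt_id (0 : ℝ)).smul_const (A u)).const_add (φ x)
  have h0 : φ x + (0 : ℝ) • A u = φ x := by simp
  -- A straight line in the chart, which stays in the fibre because its direction is vertical. The
  -- default value `x` keeps the curve in the fibre for those `t` at which the line has left the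
  -- chart.
  refine ⟨fun t => if φ x + t • A u ∈ φ.target then φ.symm (φ x + t • A u) else x, ?_, ?_, ?_⟩
  · simp [φ.left_inv hx]
  · intro t
    beta_reduce
    split_ifs with ht
    · refine ψ.injOn (h.source_subset_preimage_source (φ.map_target ht)) hfx ?_
      have h2 := hw (φ x) (φ.map_source hx)
      rw [φ.left_inv hx] at h2
      rw [hw _ ht, h2, map_add, map_smul, Prod.fst_add, Prod.smul_fst, hLA, smul_zero, add_zero]
    · rfl
  · rw [← h0] at hA'
    have h1 : ∀ C : ℝ →L[ℝ] E, A'.comp (ContinuousLinearMap.toSpanSingleton ℝ (A u)) = C →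
        HasMFDerivAt 𝓘(ℝ, ℝ) 𝓘(ℝ, E) (φ.symm ∘ fun t : ℝ => φ x + t • A u) 0 C := by
      rintro _ rfl
      exact hA'.comp (0 : ℝ) hline.hasFDerivAt.hasMFDerivAt
    have h2 : A'.comp (ContinuousLinearMap.toSpanSingleton ℝ (A u)) =
        ContinuousLinearMap.toSpanSingleton ℝ u := by
      ext
      have := congrArg (fun C : E →L[ℝ] E => C u) hAA'
      simpa using this
    refine (h1 _ h2).congr_of_eventuallyEq ?_
    filter_upwards [hline.continuousAt.preimage_mem_nhds (φ.open_target.mem_nhds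
      (by rw [h0]; exact φ.map_source hx))] with t ht
    exact if_pos ht

end Submersion

/-! ### Differential calculus on `G ⧸ H` through the projection -/

section HomogeneousCalculus

variable (E : Type*) [NormedAddCommGroup E] [NormedSpace ℝ E]
  (F : Type*) [NormedAddCommGroup F] [NormedSpace ℝ F]
  {G : Type*} [TopologicalSpace G] [ChartedSpace E G] [Group G]
  {H : Subgroup G} [ChartedSpace F (G ⧸ H)]

/-- The differential at `x` of the action of `g` on `G ⧸ H`. -/
def smulDifferential (g : G) (x : G ⧸ H) : F →L[ℝ] F :=
  mfderiv 𝓘(ℝ, F) 𝓘(ℝ, F) (fun y : G ⧸ H => g • y) x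

variable [hM : IsHomogeneousManifold E F H]

theorem contMDiff_quotient_mk :
    ContMDiff 𝓘(ℝ, E) 𝓘(ℝ, F) ∞ (QuotientGroup.mk : G → G ⧸ H) :=
  hM.isSubmersion.contMDiff

theorem exists_section_quotient_mk (a : G) :
    ∃ s : G ⧸ H → G, s (a : G ⧸ H) = a ∧
      ContMDiffAt 𝓘(ℝ, F) 𝓘(ℝ, E) ∞ s (a : G ⧸ H) ∧
      ∀ᶠ y in nhds (a : G ⧸ H), (s y : G ⧸ H) = y :=
  (hM.isSubmersion.isSubmersionAt a).exists_section

/-- A function on `G ⧸ H` is differentiable as soon as its pullback to `G` is. -/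
theorem mdifferentiableAt_of_comp_quotient_mk {f : G ⧸ H → ℝ} {a : G}
    (hf : MDifferentiableAt 𝓘(ℝ, E) 𝓘(ℝ, ℝ) (fun b : G => f (b : G ⧸ H)) a) :
    MDifferentiableAt 𝓘(ℝ, F) 𝓘(ℝ, ℝ) f (a : G ⧸ H) := by
  obtain ⟨s, hsa, hs, hsy⟩ := exists_section_quotient_mk E F (H := H) a
  rw [← hsa] at hf
  refine (hf.comp (a : G ⧸ H) (hs.mdifferentiableAt (by simp))).congr_of_eventuallyEq ?_
  filter_upwards [hsy] with y hy
  exact congrArg f hy.symm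

/-- Locally the action of `g` is a section of `p`, then left translation by `g`, then `p`. -/
theorem contMDiff_quotient_smul (E : Type*) [NormedAddCommGroup E] [NormedSpace ℝ E]
    (F : Type*) [NormedAddCommGroup F] [NormedSpace ℝ F]
    {G : Type*} [TopologicalSpace G] [ChartedSpace E G] [Group G] [LieGroup 𝓘(ℝ, E) ∞ G]
    {H : Subgroup G} [ChartedSpace F (G ⧸ H)] [IsHomogeneousManifold E F H]
    [IsManifold 𝓘(ℝ, F) ∞ (G ⧸ H)] (g : G) :
    ContMDiff 𝓘(ℝ, F) 𝓘(ℝ, F) ∞ (fun y : G ⧸ H => g • y) := by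
  intro x
  obtain ⟨a, rfl⟩ := QuotientGroup.mk_surjective x
  obtain ⟨s, hsa, hs, hsy⟩ := exists_section_quotient_mk E F (H := H) a
  have h1 : ContMDiff 𝓘(ℝ, E) 𝓘(ℝ, F) ∞ (fun b : G => ((g * b : G) : G ⧸ H)) :=
    (contMDiff_quotient_mk E F).comp contMDiff_mul_left
  refine (h1.contMDiffAt.comp (a : G ⧸ H) hs).congr_of_eventuallyEq ?_
  filter_upwards [hsy] with y hy
  change g • y = g • ((s y : G) : G ⧸ H)
  rw [hy]

variable [LieGroup 𝓘(ℝ, E) ∞ G]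

theorem Phi_mkQ (u : GroupLieAlgebra 𝓘(ℝ, E) G) :
    Phi E F H ((subgroupLieAlgebra E H).mkQ u) = projDifferential E F H u := by
  exact Submodule.liftQ_apply _ _ _

/-- Injectivity: a vector killed by `T_e p` is the velocity of a curve in the fibre over `ē`, which
is `H`. Surjectivity: the differential of a local section is a right inverse of `T_e p`. -/
theorem Phi_bijective : Function.Bijective (Phi E F H) := by
  constructor
  · rw [← LinearMap.ker_eq_bot, Phi, Submodule.ker_liftQ_eq_bot']
    refine le_antisymm (subgroupLieAlgebra_le_ker E F H) fun u hu => ?_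
    obtain ⟨c, hc, hcH, hcu⟩ :=
      (hM.isSubmersion.isSubmersionAt 1).exists_curve_in_fiber (u : E) hu
    refine ⟨c, hc, fun t => ?_, hcu⟩
    have h := QuotientGroup.eq.1 (hcH t).symm
    simpa using h
  · intro w
    obtain ⟨s, hsa, hs, hsy⟩ := exists_section_quotient_mk E F (H := H) 1
    obtain ⟨A, hA⟩ : ∃ A : F →L[ℝ] E, HasMFDerivAt 𝓘(ℝ, F) 𝓘(ℝ, E) s ((1 : G) : G ⧸ H) A :=
      ⟨_, (hs.mdifferentiableAt (by simp)).hasMFDerivAt⟩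
    obtain ⟨B, hB, hB'⟩ : ∃ B : E →L[ℝ] F,
        HasMFDerivAt 𝓘(ℝ, E) 𝓘(ℝ, F) (QuotientGroup.mk : G → G ⧸ H) (s ((1 : G) : G ⧸ H)) B ∧
        ∀ u, projDifferential E F H u = B u := by
      rw [hsa]
      exact ⟨_, ((contMDiff_quotient_mk E F).mdifferentiableAt (by simp)).hasMFDerivAt,
        fun u => rfl⟩
    have h1 := (hB.comp ((1 : G) : G ⧸ H) hA).congr_of_eventuallyEq (f₁ := id) (by
      filter_upwards [hsy] with y hy
      exact hy.symm)
    have h2 : B.comp A = ContinuousLinearMap.id ℝ F :=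
      hasMFDerivAt_unique h1 (hasMFDerivAt_id _)
    refine ⟨(subgroupLieAlgebra E H).mkQ (A w), ?_⟩
    refine (Phi_mkQ E F _).trans ?_
    exact (hB' (A w)).trans (congrArg (fun C : F →L[ℝ] F => C w) h2)

variable (H) in
/-- `Φ_e` as a linear isomorphism. -/
def PhiEquiv : (GroupLieAlgebra 𝓘(ℝ, E) G ⧸ subgroupLieAlgebra E H) ≃ₗ[ℝ]
    TangentSpace 𝓘(ℝ, F) ((1 : G) : G ⧸ H) :=
  LinearEquiv.ofBijective (Phi E F H) (Phi_bijective E F)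

variable {E F} in
theorem exists_eq_comp_Phi [FiniteDimensional ℝ F]
    (γ : Dual ℝ (GroupLieAlgebra 𝓘(ℝ, E) G ⧸ subgroupLieAlgebra E H)) :
    ∃ γ' : F →L[ℝ] ℝ, γ = γ'.toLinearMap ∘ₗ Phi E F H :=
  ⟨LinearMap.toContinuousLinearMap (E := F) (γ ∘ₗ (PhiEquiv E F H).symm.toLinearMap),
    LinearMap.ext fun w => congrArg γ ((PhiEquiv E F H).symm_apply_apply w).symm⟩

/-- The pullback of a covector at `a H` to `𝔤 ⧸ 𝔥` along `T λ_a ∘ Φ_e`. -/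
def pullCovector (a : G) (α : F →L[ℝ] ℝ) :
    Dual ℝ (GroupLieAlgebra 𝓘(ℝ, E) G ⧸ subgroupLieAlgebra E H) :=
  (α.comp (smulDifferential F a ((1 : G) : G ⧸ H))).toLinearMap ∘ₗ Phi E F H

variable {E F} in
theorem pullCovector_one (α : F →L[ℝ] ℝ) :
    pullCovector E F (H := H) 1 α = α.toLinearMap ∘ₗ Phi E F H := by
  have h1 : smulDifferential F (1 : G) ((1 : G) : G ⧸ H) = ContinuousLinearMap.id ℝ F := by
    have h3 : (fun y : G ⧸ H => (1 : G) • y) = id := funext fun y => one_smul G y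
    have h4 : HasMFDerivAt 𝓘(ℝ, F) 𝓘(ℝ, F) (fun y : G ⧸ H => (1 : G) • y) ((1 : G) : G ⧸ H)
        (ContinuousLinearMap.id ℝ F) := by
      rw [h3]
      exact hasMFDerivAt_id _
    exact h4.mfderiv
  rw [pullCovector, h1]
  rfl

variable [IsManifold 𝓘(ℝ, F) ∞ (G ⧸ H)]

theorem leftDeriv_comp_quotient_mk {f : G ⧸ H → ℝ} {a : G}
    (hf : MDifferentiableAt 𝓘(ℝ, F) 𝓘(ℝ, ℝ) f (a : G ⧸ H)) :
    (leftDeriv E (fun b : G => f (b : G ⧸ H)) a).toLinearMap =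
      (subgroupLieAlgebra E H).mkQ.dualMap
        (pullCovector E F (H := H) a (mvfderiv 𝓘(ℝ, F) f (a : G ⧸ H))) := by
  have h1 : MDifferentiableAt 𝓘(ℝ, E) 𝓘(ℝ, F) (QuotientGroup.mk : G → G ⧸ H) 1 :=
    (contMDiff_quotient_mk E F).mdifferentiableAt (by simp)
  have h2 : MDifferentiableAt 𝓘(ℝ, F) 𝓘(ℝ, F) (fun y : G ⧸ H => a • y) ((1 : G) : G ⧸ H) :=
    (contMDiff_quotient_smul E F a).mdifferentiableAt (by simp)
  -- The chain rule for `p(a b) = λ_a(p(b))`, with a free base point `y` because `a • ē` is `aH`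
  -- only up to a proof.
  have key : ∀ y : G ⧸ H, a • ((1 : G) : G ⧸ H) = y →
      MDifferentiableAt 𝓘(ℝ, F) 𝓘(ℝ, ℝ) f y → ∀ u : E,
      leftDeriv E (fun b : G => f (b : G ⧸ H)) a u =
        (mvfderiv 𝓘(ℝ, F) f y : F →L[ℝ] ℝ) (smulDifferential F a ((1 : G) : G ⧸ H)
          (projDifferential E F H u)) := by
    rintro y rfl hy u
    have h3 := hy.hasMFDerivAt.comp (1 : G) (h2.hasMFDerivAt.comp (1 : G) h1.hasMFDerivAt)
    exact congrArg (fun C : E →L[ℝ] ℝ => C u) h3.mfderiv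
  refine LinearMap.ext fun u => ?_
  refine (key (a : G ⧸ H) (by simp) hf u).trans ?_
  rfl

end HomogeneousCalculus

/-! ### The bivector on `𝔤/𝔥` associated with an invariant field -/

section AssociatedBivector

variable {E : Type*} [NormedAddCommGroup E] [NormedSpace ℝ E]
  {F : Type*} [NormedAddCommGroup F] [NormedSpace ℝ F]
  {G : Type*} [TopologicalSpace G] [ChartedSpace E G] [Group G]
  {H : Subgroup G} [ChartedSpace F (G ⧸ H)] [IsManifold 𝓘(ℝ, F) ∞ (G ⧸ H)]

/-- The value of a bivector field at a point, as a form on the dual of the model space. -/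
def BivectorField.formAt {M : Type*} [TopologicalSpace M] [ChartedSpace F M]
    [IsManifold 𝓘(ℝ, F) ∞ M] (π : BivectorField F M) (x : M) :
    (F →L[ℝ] ℝ) →L[ℝ] (F →L[ℝ] ℝ) →L[ℝ] ℝ :=
  π.toFun x

theorem BivectorField.IsInvariant.formAt_comp {π : BivectorField F (G ⧸ H)} (hπ : π.IsInvariant)
    {g : G} {x y : G ⧸ H} (hxy : g • x = y) (α β : F →L[ℝ] ℝ) :
    π.formAt x (α.comp (smulDifferential F g x)) (β.comp (smulDifferential F g x)) =
      π.formAt y α β := by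
  subst hxy
  exact hπ g x α β

variable [LieGroup 𝓘(ℝ, E) ∞ G] [IsHomogeneousManifold E F H]

theorem BivectorField.IsAssociated.formAt_eq {π : BivectorField F (G ⧸ H)}
    {r : Bivector (GroupLieAlgebra 𝓘(ℝ, E) G ⧸ subgroupLieAlgebra E H)} (hr : π.IsAssociated E r)
    (α β : F →L[ℝ] ℝ) :
    π.formAt ((1 : G) : G ⧸ H) α β =
      r.form (α.toLinearMap ∘ₗ Phi E F H) (β.toLinearMap ∘ₗ Phi E F H) :=
  hr α β

/-- For `a ∈ H` the cosets of `a g` and `a g a⁻¹` agree, so `λ_a ∘ p` is `p` after conjugation by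
`a`; differentiate at `1`. -/
theorem smulDifferential_Phi {a : H}
    (w : GroupLieAlgebra 𝓘(ℝ, E) G ⧸ subgroupLieAlgebra E H) :
    smulDifferential F (a : G) ((1 : G) : G ⧸ H) (Phi E F H w) = Phi E F H (AdBar E H a w) := by
  obtain ⟨u, rfl⟩ := (subgroupLieAlgebra E H).mkQ_surjective w
  have h1 : MDifferentiableAt 𝓘(ℝ, E) 𝓘(ℝ, F) (QuotientGroup.mk : G → G ⧸ H) 1 :=
    (contMDiff_quotient_mk E F).mdifferentiableAt (by simp)
  have h2 : MDifferentiableAt 𝓘(ℝ, F) 𝓘(ℝ, F) (fun y : G ⧸ H => (a : G) • y) ((1 : G) : G ⧸ H) :=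
    (contMDiff_quotient_smul E F (a : G)).mdifferentiableAt (by simp)
  have h3 : MDifferentiableAt 𝓘(ℝ, E) 𝓘(ℝ, E) (fun g : G => (a : G) * g * (a : G)⁻¹) 1 :=
    (((contMDiff_const (c := (a : G))).mul contMDiff_id).mul
      (contMDiff_const (c := (a : G)⁻¹)) : ContMDiff 𝓘(ℝ, E) 𝓘(ℝ, E) ∞ _).mdifferentiableAt
      (by simp)
  obtain ⟨A, hA, hA'⟩ : ∃ A : E →L[ℝ] F, HasMFDerivAt 𝓘(ℝ, E) 𝓘(ℝ, F)
      (QuotientGroup.mk : G → G ⧸ H) ((a : G) * 1 * (a : G)⁻¹) A ∧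
      ∀ u, projDifferential E F H u = A u := by
    rw [mul_one, mul_inv_cancel]
    exact ⟨_, h1.hasMFDerivAt, fun u => rfl⟩
  have h4 := (hA.comp (1 : G) h3.hasMFDerivAt).congr_of_eventuallyEq
    (f₁ := (fun y : G ⧸ H => (a : G) • y) ∘ (QuotientGroup.mk : G → G ⧸ H))
    (Filter.Eventually.of_forall fun g => by
      change (((a : G) * g : G) : G ⧸ H) = (((a : G) * g * (a : G)⁻¹ : G) : G ⧸ H)
      refine QuotientGroup.eq.2 ?_
      have h : ((a : G) * g)⁻¹ * ((a : G) * g * (a : G)⁻¹) = (a : G)⁻¹ := by group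
      rw [h]
      exact H.inv_mem a.2)
  have h5 := hasMFDerivAt_unique (h2.hasMFDerivAt.comp (1 : G) h1.hasMFDerivAt) h4
  have h6 := congrArg (fun C : E →L[ℝ] F => C u) h5
  refine h6.trans ?_
  exact (hA' (Ad E (a : G) u)).symm

/-- Elements of `H` fix `ē`, and there `Tλ_a` corresponds to the induced adjoint map under `Φ_e`;
invariance of `π` at the fixed point is the claim. -/
theorem BivectorField.IsAssociated.isAdInvariant [FiniteDimensional ℝ F]
    {π : BivectorField F (G ⧸ H)} (hπ : π.IsInvariant)
    {r : Bivector (GroupLieAlgebra 𝓘(ℝ, E) G ⧸ subgroupLieAlgebra E H)}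
    (hr : π.IsAssociated E r) : r.IsAdInvariant := by
  intro a α β
  obtain ⟨α, rfl⟩ := exists_eq_comp_Phi (F := F) α
  obtain ⟨β, rfl⟩ := exists_eq_comp_Phi (F := F) β
  have hcomp : ∀ γ : F →L[ℝ] ℝ, (γ.toLinearMap ∘ₗ Phi E F H) ∘ₗ AdBar E H a =
      (γ.comp (smulDifferential F (a : G) ((1 : G) : G ⧸ H))).toLinearMap ∘ₗ Phi E F H := fun γ =>
    LinearMap.ext fun w => congrArg γ (smulDifferential_Phi (F := F) w).symm
  rw [hcomp, hcomp, ← hr.formAt_eq, ← hr.formAt_eq]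
  refine hπ.formAt_comp ?_ α β
  change (((a : G) * 1 : G) : G ⧸ H) = ((1 : G) : G ⧸ H)
  exact QuotientGroup.eq.2 (by simp)

/-- Existence transports `π_ē` by the inverse of `Φ_e`; uniqueness holds because every covector on
`𝔤/𝔥` is a pullback along `Φ_e`. -/
theorem BivectorField.existsUnique_isAssociated [FiniteDimensional ℝ F]
    (π : BivectorField F (G ⧸ H)) :
    ∃! r : Bivector (GroupLieAlgebra 𝓘(ℝ, E) G ⧸ subgroupLieAlgebra E H), π.IsAssociated E r := by
  let e : F →ₗ[ℝ] (GroupLieAlgebra 𝓘(ℝ, E) G ⧸ subgroupLieAlgebra E H) :=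
    (PhiEquiv E F H).symm.toLinearMap
  let T : Dual ℝ (GroupLieAlgebra 𝓘(ℝ, E) G ⧸ subgroupLieAlgebra E H) →ₗ[ℝ] (F →L[ℝ] ℝ) :=
    (LinearMap.toContinuousLinearMap (𝕜 := ℝ) (E := F) (F' := ℝ)).toLinearMap ∘ₗ
      LinearMap.lcomp ℝ ℝ e
  have hT : ∀ γ : F →L[ℝ] ℝ, T (γ.toLinearMap ∘ₗ Phi E F H) = γ := fun γ =>
    ContinuousLinearMap.ext fun w => congrArg γ ((PhiEquiv E F H).apply_symm_apply w)
  have hpair : ∀ α β : F →L[ℝ] ℝ, π.formAt ((1 : G) : G ⧸ H)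
      (T (α.toLinearMap ∘ₗ Phi E F H)) (T (β.toLinearMap ∘ₗ Phi E F H)) =
        π.formAt ((1 : G) : G ⧸ H) α β := fun α β => by rw [hT, hT]
  refine ⟨⟨LinearMap.mk₂ ℝ (fun α β => π.formAt ((1 : G) : G ⧸ H) (T α) (T β))
    (by simp) (by simp) (by simp) (by simp), fun α => π.alternating _ _⟩, ?_, ?_⟩
  · intro α β
    exact (hpair α β).symm
  · intro r hr
    refine Bivector.ext (LinearMap.ext fun α => LinearMap.ext fun β => ?_)
    obtain ⟨α, rfl⟩ := exists_eq_comp_Phi (F := F) α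
    obtain ⟨β, rfl⟩ := exists_eq_comp_Phi (F := F) β
    rw [← hr.formAt_eq]
    exact (hpair α β).symm

end AssociatedBivector

/-! ### Iterated brackets and the Schouten–Nijenhuis bracket computed on the group -/

section InvariantPoisson

variable {E : Type*} [NormedAddCommGroup E] [NormedSpace ℝ E]
  {F : Type*} [NormedAddCommGroup F] [NormedSpace ℝ F]
  {G : Type*} [TopologicalSpace G] [ChartedSpace E G] [Group G] [LieGroup 𝓘(ℝ, E) ∞ G]
  {H : Subgroup G} [ChartedSpace F (G ⧸ H)] [IsHomogeneousManifold E F H]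

variable (E) in
/-- The left-trivialised differential at `a` of the pullback to `G` of a function on `G ⧸ H`, as a
linear form on the Lie algebra. -/
def leftCovector (f : G ⧸ H → ℝ) (a : G) : Dual ℝ (GroupLieAlgebra 𝓘(ℝ, E) G) :=
  (leftDeriv E (fun b : G => f (b : G ⧸ H)) a).toLinearMap

/-- `B` is the second derivative at `a` of the pullback to `G` of `f` along left-invariant vector
fields. -/
def IsLeftHessian (f : G ⧸ H → ℝ) (a : G) (B : E →L[ℝ] E →L[ℝ] ℝ) : Prop :=
  HasMFDerivAt 𝓘(ℝ, E) 𝓘(ℝ, E →L[ℝ] ℝ) (leftDeriv E (fun b : G => f ((a * b : G) : G ⧸ H))) 1 B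

theorem exists_isLeftHessian {f : G ⧸ H → ℝ} {a : G}
    (hf : ContMDiffAt 𝓘(ℝ, F) 𝓘(ℝ, ℝ) ∞ f (a : G ⧸ H)) :
    ∃ B : E →L[ℝ] E →L[ℝ] ℝ, IsLeftHessian f a B ∧
      ∀ u v : GroupLieAlgebra 𝓘(ℝ, E) G, B u v - B v u = leftCovector E f a ⁅u, v⁆ := by
  have h1 : ContMDiffAt 𝓘(ℝ, E) 𝓘(ℝ, ℝ) ∞ (fun b : G => f ((a * b : G) : G ⧸ H)) 1 := by
    rw [← mul_one a] at hf
    exact ContMDiffAt.comp (1 : G) hf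
      ((contMDiff_quotient_mk E F).comp contMDiff_mul_left).contMDiffAt
  obtain ⟨B, hB, hB'⟩ := exists_hasMFDerivAt_leftDeriv h1
  refine ⟨B, hB, fun u v => ?_⟩
  rw [hB', leftDeriv_mul_left (fun x : G => f (x : G ⧸ H)), mul_one]
  rfl

variable [IsManifold 𝓘(ℝ, F) ∞ (G ⧸ H)]

/-- The bracket of an invariant bivector field, computed on the group. -/
theorem BivectorField.bracket_quotient_mk {π : BivectorField F (G ⧸ H)} (hπ : π.IsInvariant)
    {rt : Bivector (GroupLieAlgebra 𝓘(ℝ, E) G)}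
    (hrt : π.IsAssociated E (rt.map (subgroupLieAlgebra E H).mkQ))
    {f g : G ⧸ H → ℝ} {a : G} (hf : MDifferentiableAt 𝓘(ℝ, F) 𝓘(ℝ, ℝ) f (a : G ⧸ H))
    (hg : MDifferentiableAt 𝓘(ℝ, F) 𝓘(ℝ, ℝ) g (a : G ⧸ H)) :
    π.bracket f g (a : G ⧸ H) = rt.form (leftCovector E f a) (leftCovector E g a) := by
  rw [leftCovector, leftCovector, leftDeriv_comp_quotient_mk E F hf,
    leftDeriv_comp_quotient_mk E F hg]
  refine (hπ.formAt_comp (by simp : a • ((1 : G) : G ⧸ H) = (a : G ⧸ H)) _ _).symm.trans ?_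
  exact hrt.formAt_eq _ _

variable [FiniteDimensional ℝ E]

/-- In the left trivialisation an invariant bivector field has constant coefficients, so the product
rule differentiates only the two covectors, and each contributes its left Hessian. -/
theorem hasMFDerivAt_bracket {π : BivectorField F (G ⧸ H)} (hπ : π.IsInvariant)
    {rt : Bivector (GroupLieAlgebra 𝓘(ℝ, E) G)}
    (hrt : π.IsAssociated E (rt.map (subgroupLieAlgebra E H).mkQ))
    {f g : G ⧸ H → ℝ} {a : G} (hf : ContMDiffAt 𝓘(ℝ, F) 𝓘(ℝ, ℝ) ∞ f (a : G ⧸ H))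
    (hg : ContMDiffAt 𝓘(ℝ, F) 𝓘(ℝ, ℝ) ∞ g (a : G ⧸ H))
    {Bf Bg : E →L[ℝ] E →L[ℝ] ℝ} (hBf : IsLeftHessian f a Bf) (hBg : IsLeftHessian g a Bg) :
    ∃ D : E →L[ℝ] ℝ, HasMFDerivAt 𝓘(ℝ, E) 𝓘(ℝ, ℝ)
        (fun b : G => π.bracket f g ((a * b : G) : G ⧸ H)) 1 D ∧
      ∀ v : E, D v = Bg v (rt.sharp (leftCovector E f a)) - Bf v (rt.sharp (leftCovector E g a)) := by
  let J : (E →L[ℝ] ℝ) → Dual ℝ (GroupLieAlgebra 𝓘(ℝ, E) G) := fun δ => δ.toLinearMap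
  obtain ⟨R, hR⟩ : ∃ R : (E →L[ℝ] ℝ) →L[ℝ] (E →L[ℝ] ℝ) →L[ℝ] ℝ,
      ∀ α β : E →L[ℝ] ℝ, R α β = rt.form (J α) (J β) :=
    Bivector.exists_continuous_form (E := E) rt
  have hloc : ∀ᶠ b in nhds (1 : G), π.bracket f g ((a * b : G) : G ⧸ H) =
      R (leftDeriv E (fun x : G => f ((a * x : G) : G ⧸ H)) b)
        (leftDeriv E (fun x : G => g ((a * x : G) : G ⧸ H)) b) := by
    have hc : Filter.Tendsto (fun b : G => ((a * b : G) : G ⧸ H)) (nhds 1)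
        (nhds (a : G ⧸ H)) := by
      have h := (((contMDiff_quotient_mk E F (H := H)).comp
        (contMDiff_mul_left (n := ∞) (a := a))).continuous).tendsto (1 : G)
      simpa [Function.comp_def] using h
    have hd : ∀ {k : G ⧸ H → ℝ}, ContMDiffAt 𝓘(ℝ, F) 𝓘(ℝ, ℝ) ∞ k (a : G ⧸ H) →
        ∀ᶠ b in nhds (1 : G), MDifferentiableAt 𝓘(ℝ, F) 𝓘(ℝ, ℝ) k ((a * b : G) : G ⧸ H) := by
      intro k hk
      filter_upwards [hc.eventually ((contMDiffAt_iff_contMDiffAt_nhds (by simp)).1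
        (hk.of_le (by simp : (1 : WithTop ℕ∞) ≤ ∞)))] with b hb
      exact hb.mdifferentiableAt (by simp)
    filter_upwards [hd hf, hd hg] with b hbf hbg
    rw [BivectorField.bracket_quotient_mk hπ hrt hbf hbg,
      leftDeriv_mul_left (fun x : G => f (x : G ⧸ H)), leftDeriv_mul_left (fun x : G => g (x : G ⧸ H)), hR]
    rfl
  have h1 := R.isBoundedBilinearMap.hasFDerivAt
    (leftDeriv E (fun x : G => f ((a * x : G) : G ⧸ H)) 1,
      leftDeriv E (fun x : G => g ((a * x : G) : G ⧸ H)) 1)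
  have h2 : HasMFDerivAt 𝓘(ℝ, E) 𝓘(ℝ, (E →L[ℝ] ℝ) × (E →L[ℝ] ℝ)) (fun b : G =>
      (leftDeriv E (fun x : G => f ((a * x : G) : G ⧸ H)) b,
        leftDeriv E (fun x : G => g ((a * x : G) : G ⧸ H)) b)) 1 (Bf.prod Bg) :=
    ⟨ContinuousAt.prodMk hBf.1 hBg.1, HasFDerivWithinAt.prodMk hBf.2 hBg.2⟩
  have hJ : ∀ k : G ⧸ H → ℝ, J (leftDeriv E (fun x : G => k ((a * x : G) : G ⧸ H)) 1) =
      leftCovector E k a := by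
    intro k
    rw [leftDeriv_mul_left (fun x : G => k (x : G ⧸ H)), mul_one]
    rfl
  have h2' := HasMFDerivAt.comp (1 : G) h1.hasMFDerivAt h2
  have h3 : ∃ D : E →L[ℝ] ℝ, HasMFDerivAt 𝓘(ℝ, E) 𝓘(ℝ, ℝ)
      (fun b : G => π.bracket f g ((a * b : G) : G ⧸ H)) 1 D ∧
      ∀ v : E, D v = R (leftDeriv E (fun x : G => f ((a * x : G) : G ⧸ H)) 1) (Bg v) +
        R (Bf v) (leftDeriv E (fun x : G => g ((a * x : G) : G ⧸ H)) 1) :=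
    ⟨_, h2'.congr_of_eventuallyEq hloc, fun v => rfl⟩
  obtain ⟨D, hD, hDv⟩ := h3
  refine ⟨D, hD, fun v => ?_⟩
  have hsharp : ∀ (δ : E →L[ℝ] ℝ) (k : G ⧸ H → ℝ),
      rt.form (leftCovector E k a) (J δ) = δ (rt.sharp (leftCovector E k a)) := fun δ k =>
    (rt.apply_sharp _ _).symm
  -- Skew-symmetry moves the differentiated covector of `f` into the second slot, which produces the
  -- minus sign.
  rw [hDv, hR, hR, hJ, hJ, rt.form_swap (J (Bf v)), hsharp, hsharp]
  exact (sub_eq_add_neg _ _).symm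

/-- The iterated bracket of an invariant bivector field. -/
theorem BivectorField.bracket_bracket {π : BivectorField F (G ⧸ H)} (hπ : π.IsInvariant)
    {rt : Bivector (GroupLieAlgebra 𝓘(ℝ, E) G)}
    (hrt : π.IsAssociated E (rt.map (subgroupLieAlgebra E H).mkQ))
    {f g h : G ⧸ H → ℝ} {a : G} (hf : ContMDiffAt 𝓘(ℝ, F) 𝓘(ℝ, ℝ) ∞ f (a : G ⧸ H))
    (hg : ContMDiffAt 𝓘(ℝ, F) 𝓘(ℝ, ℝ) ∞ g (a : G ⧸ H))
    (hh : ContMDiffAt 𝓘(ℝ, F) 𝓘(ℝ, ℝ) ∞ h (a : G ⧸ H))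
    {Bf Bg : E →L[ℝ] E →L[ℝ] ℝ} (hBf : IsLeftHessian f a Bf) (hBg : IsLeftHessian g a Bg) :
    π.bracket (π.bracket f g) h (a : G ⧸ H) =
      Bf (rt.sharp (leftCovector E h a)) (rt.sharp (leftCovector E g a)) -
        Bg (rt.sharp (leftCovector E h a)) (rt.sharp (leftCovector E f a)) := by
  obtain ⟨D, hD, hDv⟩ := hasMFDerivAt_bracket hπ hrt hf hg hBf hBg
  -- Differentiability of the inner bracket is known for its pullback to `G` translated by `a`:
  -- translate back by `a⁻¹`, then descend along the submersion.
  have hdiff : MDifferentiableAt 𝓘(ℝ, F) 𝓘(ℝ, ℝ) (π.bracket f g) (a : G ⧸ H) := by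
    refine mdifferentiableAt_of_comp_quotient_mk E F ?_
    have h1 : MDifferentiableAt 𝓘(ℝ, E) 𝓘(ℝ, ℝ)
        (fun b : G => π.bracket f g ((a * b : G) : G ⧸ H)) (a⁻¹ * a) := by
      rw [inv_mul_cancel]
      exact hD.mdifferentiableAt
    have h2 := h1.comp a ((contMDiff_mul_left (I := 𝓘(ℝ, E)) (n := ∞)
      (a := a⁻¹)).mdifferentiableAt (by simp))
    refine h2.congr_of_eventuallyEq (Filter.Eventually.of_forall fun b => ?_)
    simp
  rw [BivectorField.bracket_quotient_mk hπ hrt hdiff (hh.mdifferentiableAt (by simp)),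
    rt.form_swap, ← rt.apply_sharp]
  have h3 : leftDeriv E (fun b : G => π.bracket f g (b : G ⧸ H)) a = D := hD.mfderiv
  have h4 : ∀ v : E, leftCovector E (π.bracket f g) a v = D v := fun v =>
    congrArg (fun C : E →L[ℝ] ℝ => C v) h3
  rw [← neg_sub, neg_inj]
  exact (h4 _).trans (hDv _)

theorem contMDiffAt_covectorFun {M : Type*} [TopologicalSpace M] [ChartedSpace F M]
    [IsManifold 𝓘(ℝ, F) ∞ M] (x : M) (α : F →L[ℝ] ℝ) :
    ContMDiffAt 𝓘(ℝ, F) 𝓘(ℝ, ℝ) ∞ (covectorFun x α) x :=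
  ContMDiffAt.comp x α.contDiff.contMDiff.contMDiffAt contMDiffAt_extChartAt

/-- The preferred chart has identity differential at its centre, so the test functions in the
Schouten bracket realise all covectors. -/
theorem mvfderiv_covectorFun {M : Type*} [TopologicalSpace M] [ChartedSpace F M]
    [IsManifold 𝓘(ℝ, F) ∞ M] (x : M) (α : F →L[ℝ] ℝ) :
    (mvfderiv 𝓘(ℝ, F) (covectorFun (F := F) x α) x : F →L[ℝ] ℝ) = α := by
  obtain ⟨A, hA, hA1⟩ : ∃ A : F →L[ℝ] F, HasMFDerivAt 𝓘(ℝ, F) 𝓘(ℝ, F)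
      (extChartAt 𝓘(ℝ, F) x) x A ∧ A = ContinuousLinearMap.id ℝ F :=
    ⟨_, (mdifferentiableAt_extChartAt (mem_chart_source F x)).hasMFDerivAt,
      mfderiv_extChartAt_self⟩
  subst hA1
  exact (α.hasFDerivAt.hasMFDerivAt.comp x hA).mfderiv

/-- The Schouten–Nijenhuis bracket of an invariant bivector field in terms of the Yang–Baxter-type
tensor. -/
theorem schoutenBracket_quotient_mk {π : BivectorField F (G ⧸ H)} (hπ : π.IsInvariant)
    {rt : Bivector (GroupLieAlgebra 𝓘(ℝ, E) G)}
    (hrt : π.IsAssociated E (rt.map (subgroupLieAlgebra E H).mkQ)) (a : G) (α β γ : F →L[ℝ] ℝ) :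
    schoutenBracket π π (a : G ⧸ H) α β γ =
      2 * yangBaxterOfLift (subgroupLieAlgebra E H) rt (pullCovector E F a α)
        (pullCovector E F a β) (pullCovector E F a γ) := by
  have hsm := contMDiffAt_covectorFun (F := F) (a : G ⧸ H)
  have hcov : ∀ δ : F →L[ℝ] ℝ, (subgroupLieAlgebra E H).mkQ.dualMap (pullCovector E F a δ) =
      leftCovector E (covectorFun (F := F) (a : G ⧸ H) δ) a := by
    intro δ
    have h := leftDeriv_comp_quotient_mk E F ((hsm δ).mdifferentiableAt (by simp))
    rw [mvfderiv_covectorFun] at h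
    exact h.symm
  rw [yangBaxterOfLift_apply, hcov, hcov, hcov]
  obtain ⟨B₁, hB₁, hB₁'⟩ := exists_isLeftHessian (E := E) (hsm α)
  obtain ⟨B₂, hB₂, hB₂'⟩ := exists_isLeftHessian (E := E) (hsm β)
  obtain ⟨B₃, hB₃, hB₃'⟩ := exists_isLeftHessian (E := E) (hsm γ)
  have e₁ := BivectorField.bracket_bracket hπ hrt (hsm α) (hsm β) (hsm γ) hB₁ hB₂
  have e₂ := BivectorField.bracket_bracket hπ hrt (hsm β) (hsm γ) (hsm α) hB₂ hB₃
  have e₃ := BivectorField.bracket_bracket hπ hrt (hsm γ) (hsm α) (hsm β) hB₃ hB₁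
  -- Each Hessian occurs in two of the three iterated brackets, with opposite signs and swapped
  -- arguments. The factor 2 comes from the two equal summands for `P = Q`.
  rw [← hB₁', ← hB₂', ← hB₃']
  simp only [schoutenBracket]
  erw [e₁, e₂, e₃]
  ring

end InvariantPoisson

/-! ### Differentiating along `H`: subalgebra property and infinitesimal invariance -/

section SubgroupLieAlgebra

variable {E : Type*} [NormedAddCommGroup E] [NormedSpace ℝ E] [FiniteDimensional ℝ E]
  {G : Type*} [TopologicalSpace G] [ChartedSpace E G] [Group G] [LieGroup 𝓘(ℝ, E) ∞ G]
  {H : Subgroup G}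

/-- The Lie algebra of a subgroup is closed under the Lie bracket. -/
theorem lie_mem_subgroupLieAlgebra {u v : GroupLieAlgebra 𝓘(ℝ, E) G}
    (hu : u ∈ subgroupLieAlgebra E H) (hv : v ∈ subgroupLieAlgebra E H) :
    ⁅u, v⁆ ∈ subgroupLieAlgebra E H := by
  have := FiniteDimensional.complete ℝ E
  obtain ⟨c, hc, hcH, hcu⟩ := hu
  obtain ⟨D, hD, hDv⟩ := exists_hasDerivAt_AdL hc hcu
  rw [← Submodule.Quotient.mk_eq_zero, ← Submodule.mkQ_apply,
    ← Module.forall_dual_apply_eq_zero_iff ℝ]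
  intro η
  let α : E →L[ℝ] ℝ := LinearMap.toContinuousLinearMap (𝕜 := ℝ) (E := E)
    (η ∘ₗ (subgroupLieAlgebra E H).mkQ)
  let v' : E := v
  have h1 : HasDerivAt (fun t => α (AdL E (c t) v')) (α (D v')) 0 := by
    have h := hD.clm_apply (hasDerivAt_const (0 : ℝ) v')
    rw [map_zero, add_zero] at h
    exact α.hasFDerivAt.comp_hasDerivAt (0 : ℝ) h
  -- The curve `Ad_{c(t)} v` stays in `𝔥`, on which `α` vanishes; its derivative at `0` is `[u, v]`,
  -- so `α` kills the bracket too.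
  have h2 : (fun t => α (AdL E (c t) v')) = fun _ => 0 := by
    funext t
    have h3 : Ad E (c t) v ∈ subgroupLieAlgebra E H := Ad_mem E H (hcH t) hv
    have h4 := (Submodule.Quotient.mk_eq_zero _).2 h3
    exact (congrArg η h4).trans (map_zero η)
  rw [h2] at h1
  have h5 : α (D v') = 0 := h1.unique (hasDerivAt_const _ _)
  exact (congrArg α (hDv v)).symm.trans h5

/-- An `Ad(H)`-invariant form is infinitesimally invariant. -/
theorem Bivector.IsAdInvariant.lie_sharp
    {rt : Bivector (GroupLieAlgebra 𝓘(ℝ, E) G)}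
    (hr : (rt.map (subgroupLieAlgebra E H).mkQ).IsAdInvariant)
    {u : GroupLieAlgebra 𝓘(ℝ, E) G} (hu : u ∈ subgroupLieAlgebra E H)
    (η ξ : Dual ℝ (GroupLieAlgebra 𝓘(ℝ, E) G ⧸ subgroupLieAlgebra E H)) :
    (subgroupLieAlgebra E H).mkQ.dualMap ξ
        ⁅u, rt.sharp ((subgroupLieAlgebra E H).mkQ.dualMap η)⁆ =
      (subgroupLieAlgebra E H).mkQ.dualMap η
        ⁅u, rt.sharp ((subgroupLieAlgebra E H).mkQ.dualMap ξ)⁆ := by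
  have := FiniteDimensional.complete ℝ E
  obtain ⟨c, hc, hcH, hcu⟩ := hu
  obtain ⟨D, hD, hDv⟩ := exists_hasDerivAt_AdL hc hcu
  let J : (E →L[ℝ] ℝ) → Dual ℝ (GroupLieAlgebra 𝓘(ℝ, E) G) := fun δ => δ.toLinearMap
  obtain ⟨R, hR⟩ : ∃ R : (E →L[ℝ] ℝ) →L[ℝ] (E →L[ℝ] ℝ) →L[ℝ] ℝ,
      ∀ α β : E →L[ℝ] ℝ, R α β = rt.form (J α) (J β) :=
    Bivector.exists_continuous_form (E := E) rt
  let K : Dual ℝ (GroupLieAlgebra 𝓘(ℝ, E) G ⧸ subgroupLieAlgebra E H) → (E →L[ℝ] ℝ) := fun η =>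
    LinearMap.toContinuousLinearMap (𝕜 := ℝ) (E := E) (η ∘ₗ (subgroupLieAlgebra E H).mkQ)
  have hJK : ∀ η, J (K η) = (subgroupLieAlgebra E H).mkQ.dualMap η := fun η => rfl
  have hd : ∀ η, HasDerivAt (fun t => (K η).comp (AdL E (c t))) ((K η).comp D) 0 := by
    intro η
    simpa using (hasDerivAt_const (0 : ℝ) (K η)).clm_comp hD
  -- Differentiate `r(η ∘ Ad_{c(t)}, ξ ∘ Ad_{c(t)})` at `t = 0`; by invariance this function is
  -- constant.
  have h1 := (R.hasFDerivAt.comp_hasDerivAt (0 : ℝ) (hd η)).clm_apply (hd ξ)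
  have h2 : (fun t => R ((K η).comp (AdL E (c t))) ((K ξ).comp (AdL E (c t)))) =
      fun _ => R (K η) (K ξ) := by
    funext t
    have h3 : ∀ η, J ((K η).comp (AdL E (c t))) = (subgroupLieAlgebra E H).mkQ.dualMap
        (η ∘ₗ AdBar E H ⟨c t, hcH t⟩) := fun η => LinearMap.ext fun v => rfl
    rw [hR, hR, h3, h3]
    exact hr ⟨c t, hcH t⟩ η ξ
  have hAd0 : AdL E (c 0) = ContinuousLinearMap.id ℝ E := by
    rw [hc]
    have h3 : (fun g : G => (1 : G) * g * (1 : G)⁻¹) = id := by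
      funext g
      simp
    have h4 : HasMFDerivAt 𝓘(ℝ, E) 𝓘(ℝ, E) (fun g : G => (1 : G) * g * (1 : G)⁻¹) 1
        (ContinuousLinearMap.id ℝ E) := by
      rw [h3]
      exact hasMFDerivAt_id (1 : G)
    exact h4.mfderiv
  have h5 : HasDerivAt (fun _ : ℝ => R (K η) (K ξ))
      (R ((K η).comp D) ((K ξ).comp (AdL E (c 0))) +
        R ((K η).comp (AdL E (c 0))) ((K ξ).comp D)) 0 := h2 ▸ h1
  have h6 := h5.unique (hasDerivAt_const _ _)
  rw [hAd0, ContinuousLinearMap.comp_id, ContinuousLinearMap.comp_id, hR, hR,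
    rt.form_swap, hJK, hJK, ← rt.apply_sharp, ← rt.apply_sharp] at h6
  have h7 : ∀ (η : Dual ℝ (GroupLieAlgebra 𝓘(ℝ, E) G ⧸ subgroupLieAlgebra E H))
      (w : GroupLieAlgebra 𝓘(ℝ, E) G), J ((K η).comp D) w =
        (subgroupLieAlgebra E H).mkQ.dualMap η ⁅u, w⁆ := fun η w => congrArg (K η) (hDv w)
  rw [h7, h7] at h6
  linarith

/-- The algebraic comparison of two lifts applies to `rt` and the chosen lift; its hypotheses on `𝔥`
are the two results just obtained by differentiating along `H`. -/
theorem Bivector.IsAdInvariant.yangBaxterOfLift_eq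
    {r : Bivector (GroupLieAlgebra 𝓘(ℝ, E) G ⧸ subgroupLieAlgebra E H)} (hr : r.IsAdInvariant)
    {rt : Bivector (GroupLieAlgebra 𝓘(ℝ, E) G)} (hrt : rt.map (subgroupLieAlgebra E H).mkQ = r) :
    yangBaxterOfLift (subgroupLieAlgebra E H) rt = yangBaxter (subgroupLieAlgebra E H) r := by
  subst hrt
  have hspec := (Bivector.exists_lift (subgroupLieAlgebra E H)
    (rt.map (subgroupLieAlgebra E H).mkQ)).choose_spec
  have hS : ∀ u ∈ subgroupLieAlgebra E H, ∀ v ∈ subgroupLieAlgebra E H,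
      ⁅u, v⁆ ∈ subgroupLieAlgebra E H := fun u hu v hv => lie_mem_subgroupLieAlgebra hu hv
  have hinv := fun u (hu : u ∈ subgroupLieAlgebra E H) => hr.lie_sharp hu
  rw [yangBaxter]
  generalize (Bivector.exists_lift (subgroupLieAlgebra E H)
    (rt.map (subgroupLieAlgebra E H).mkQ)).choose = rt' at hspec ⊢
  exact yangBaxterOfLift_eq_of_map_eq (subgroupLieAlgebra E H) hS rt rt' hspec.symm hinv

end SubgroupLieAlgebra

/-! ### The Poisson criterion and the main theorem -/

section PoissonIff

variable {E : Type*} [NormedAddCommGroup E] [NormedSpace ℝ E] [FiniteDimensional ℝ E]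
  {F : Type*} [NormedAddCommGroup F] [NormedSpace ℝ F] [FiniteDimensional ℝ F]
  {G : Type*} [TopologicalSpace G] [ChartedSpace E G] [Group G] [LieGroup 𝓘(ℝ, E) ∞ G]
  {H : Subgroup G} [ChartedSpace F (G ⧸ H)] [IsManifold 𝓘(ℝ, F) ∞ (G ⧸ H)]
  [IsHomogeneousManifold E F H]

/-- At `ē` the pulled-back covectors exhaust `(𝔤/𝔥)*`, so vanishing of the bracket there already
forces the tensor to vanish. Conversely, the same tensor computes the bracket at every point `aH`.
-/
theorem BivectorField.isPoisson_iff_yangBaxter_eq_zero {π : BivectorField F (G ⧸ H)}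
    (hπ : π.IsInvariant)
    {r : Bivector (GroupLieAlgebra 𝓘(ℝ, E) G ⧸ subgroupLieAlgebra E H)}
    (hr : π.IsAssociated E r) :
    π.IsPoisson ↔ yangBaxter (subgroupLieAlgebra E H) r = 0 := by
  have hlift := (Bivector.exists_lift (subgroupLieAlgebra E H) r).choose_spec
  rw [← hlift] at hr
  rw [yangBaxter]
  constructor
  · intro h
    refine LinearMap.ext fun η => LinearMap.ext fun ξ => LinearMap.ext fun ε => ?_
    obtain ⟨α, rfl⟩ := exists_eq_comp_Phi (F := F) η
    obtain ⟨β, rfl⟩ := exists_eq_comp_Phi (F := F) ξ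
    obtain ⟨γ, rfl⟩ := exists_eq_comp_Phi (F := F) ε
    have h1 := schoutenBracket_quotient_mk hπ hr 1 α β γ
    rw [pullCovector_one, pullCovector_one, pullCovector_one] at h1
    have h2 : schoutenBracket π π ((1 : G) : G ⧸ H) α β γ = 0 := by
      rw [h]
      rfl
    simpa [h2] using h1.symm
  · intro h x
    obtain ⟨a, rfl⟩ := QuotientGroup.mk_surjective x
    funext α β γ
    refine (schoutenBracket_quotient_mk hπ hr a α β γ).trans ?_
    rw [h]
    simp

end PoissonIff

theorem mainTheorem1
    {E : Type*} [NormedAddCommGroup E] [NormedSpace ℝ E] [FiniteDimensional ℝ E]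
    {F : Type*} [NormedAddCommGroup F] [NormedSpace ℝ F] [FiniteDimensional ℝ F]
    {G : Type*} [TopologicalSpace G] [ChartedSpace E G] [Group G] [LieGroup 𝓘(ℝ, E) ∞ G]
    [ConnectedSpace G]
    (H : Subgroup G) (hH : IsClosed (H : Set G))
    [ChartedSpace F (G ⧸ H)] [IsManifold 𝓘(ℝ, F) ∞ (G ⧸ H)] [IsHomogeneousManifold E F H] :
    (∀ r : Bivector (GroupLieAlgebra 𝓘(ℝ, E) G ⧸ subgroupLieAlgebra E H), r.IsAdInvariant →
      ∀ rt : Bivector (GroupLieAlgebra 𝓘(ℝ, E) G), rt.map (subgroupLieAlgebra E H).mkQ = r →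
        yangBaxterOfLift (subgroupLieAlgebra E H) rt = yangBaxter (subgroupLieAlgebra E H) r) ∧
    ∀ π : BivectorField F (G ⧸ H), π.IsInvariant →
      (∃! r : Bivector (GroupLieAlgebra 𝓘(ℝ, E) G ⧸ subgroupLieAlgebra E H),
        π.IsAssociated E r) ∧
      ∀ r : Bivector (GroupLieAlgebra 𝓘(ℝ, E) G ⧸ subgroupLieAlgebra E H), π.IsAssociated E r →
        r.IsAdInvariant ∧ (π.IsPoisson ↔ yangBaxter (subgroupLieAlgebra E H) r = 0) := by
  refine ⟨fun r hr rt hrt => hr.yangBaxterOfLift_eq hrt, fun π hπ => ?_⟩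
  exact ⟨π.existsUnique_isAssociated, fun r hr =>
    ⟨hr.isAdInvariant hπ, BivectorField.isPoisson_iff_yangBaxter_eq_zero hπ hr⟩⟩

end
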